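/- Let $D\ge 1$ and let $\Gamma=\mathbb Z^D$ carry its graph metric, with balls $b_u(N)$. Each site $x$ carries a finite-dimensional Hilbert space $\mathcal H_x$; for finite $\Lambda\subset\Gamma$ put $\mathcal H_\Lambda=\bigotimes_{x\in\Lambda}\mathcal H_x$, and for finite $Z\subset\Gamma$ let a Lindbladian supported in $Z$ be a superoperator in Lindblad form on $\mathcal B(\mathcal H_Z)$, acting on $\mathcal B(\mathcal H_\Lambda)$, $\Lambda\supset Z$, by tensoring with the identity. Write $\|\cdot\|_1$ for the trace norm and $\|\cdot\|_\diamond$ for the diamond norm. A uniform family $\mathcal L=(\mathcal M,\mathcal B)$ consists of Lindbladians $\mathcal M_Z$ supported in $Z$, for all finite $Z\subset\Gamma$, and, for every ball $\Lambda=b_u(N)$, of Lindbladians $\mathcal B^{\partial\Lambda}_d$, $1\le d\le N+1$, supported in $\partial_d\Lambda=\{x\in\Lambda:\operatorname{dist}(x,\Lambda^c)\le d\}$ (since $\partial_{N+1}\Lambda=\Lambda$, larger $d$ would add nothing). Assume that there are $v\ge 0$ and a positive nondecreasing function $\nu$ with $\nu(r+s)\le\nu(r)\nu(s)$ such that $$\sup_{x\in\Gamma}\sum_{Z\ni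 x}\|\mathcal M_Z\|_\diamond\,|Z|\,\nu(\operatorname{diam}Z)\le v,\qquad \sup_{x\in\Gamma}\sup_{r\ge 1}\nu(r)\sum_{d=r}^{N+1}\|\mathcal B_d^{\partial b_x(N)}\|_\diamond\le \mathrm{poly}(N).$$ Call a finite set $\Lambda$ a disjoint union of balls if $\Lambda=\bigcup_i\Lambda_i$ for finitely many balls $\Lambda_i$ with sites of different $\Lambda_i$ at distance at least $2$ (so the $\Lambda_i$ are the connected components of $\Lambda$). For such $\Lambda$ put $\mathcal B^{\partial\Lambda}_d=\sum_i\mathcal B^{\partial\Lambda_i}_d$ and let $$T_t^{\bar\Lambda}=\exp(t\mathcal L^{\bar\Lambda}),\qquad \mathcal L^{\bar\Lambda}=\sum_{Z\subset\Lambda}\mathcal M_Z+\sum_{d\ge 1}\mathcal B_d^{\partial\Lambda}$$ be the evolution with closed boundary. Assume that $\mathcal L$ is frustration free: for every disjoint union of balls $\Lambda$ and every state $\rho_\infty$ on $\Lambda$ fixed by $T_t^{\bar\Lambda}$ for all $t\ge 0$, $\mathcal M_Z(\rho_\infty)=0$ for all $Z\subset\Lambda$. For a finite $A\subset\Gamma$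 and $s\ge 0$ let $A(s)$ denote a disjoint union of balls that contains $\{x:\operatorname{dist}(x,A)\le s\}$ and has the smallest possible number of sites. Then for every finite $A\subset\Gamma$ there is a real polynomial $\mathrm{poly}$ (depending only on the family, $\nu$, $v$ and $A$) such that for every integer $m\ge 1$ and all choices of $A(m)$ and $B=A(m+1)$ with $A(m)\subset A(m+1)$, with $R=A(m+1)\setminus A(m)$, for every state $\rho^m_\infty$ on $A(m)$ that is fixed by $T_t^{\overline{A(m)}}$ for all $t\ge 0$, every state $\tau$ on $R$, and every $t\ge 0$, $$\Big\|\big(T_t^{\bar B}-T_t^{\bar B\setminus A}\big)(\rho^m_\infty\otimes\tau)\Big\|_1\le \mathrm{poly}(m)\,\nu^{-1}(m)\,\big[e^{vt}-1+t\big],$$ where $\nu^{-1}(m)=1/\nu(m)$ and $T_t^{\bar B\setminus A}=\exp(t\mathcal L^{\bar B\setminus A})$ is the evolution on $B$ generated by $$\mathcal L^{\bar B\setminus A}=\sum_{Z\subset B\setminus A}\mathcal M_Z+\sum_{d\le m+1}\mathcal B_d^{\partial B}.$$ -/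

import Mathlib

open scoped ENNReal Matrix ComplexOrder

namespace OpenLattice

noncomputable section

/-! ### Matrices, superoperators, norms -/

/-- Superoperators: linear maps on the algebra of operators, in matrix form. -/
abbrev Superop (ι : Type) : Type := Matrix ι ι ℂ →ₗ[ℂ] Matrix ι ι ℂ

section Norms

variable {ι : Type} [Fintype ι] [DecidableEq ι]

/-- The trace norm `‖X‖₁`, the sum of the singular values of `X`, i.e. of the square roots of the
eigenvalues of `Xᴴ X`. -/
def traceNorm (X : Matrix ι ι ℂ) : ℝ :=
  ∑ i, Real.sqrt ((Matrix.isHermitian_conjTranspose_mul_self X).eigenvalues i)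

/-- `T ⊗ id` on `B(ℂ^ι) ⊗ M_n`. -/
def ampliate (T : Superop ι) (n : ℕ) (X : Matrix (ι × Fin n) (ι × Fin n) ℂ) :
    Matrix (ι × Fin n) (ι × Fin n) ℂ :=
  Matrix.of fun p r => T (Matrix.of fun a b => X (a, p.2) (b, r.2)) p.1 r.1

/-- The diamond norm `sup_n ‖T ⊗ id_n‖_{1 → 1}`, as an extended nonnegative real. -/
def diamondNorm (T : Superop ι) : ℝ≥0∞ :=
  ⨆ (n : ℕ) (X : Matrix (ι × Fin n) (ι × Fin n) ℂ) (_ : X ≠ 0),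
    ENNReal.ofReal (traceNorm (ampliate T n X)) / ENNReal.ofReal (traceNorm X)

/-- A state (density matrix). -/
def IsState (ρ : Matrix ι ι ℂ) : Prop := ρ.PosSemidef ∧ ρ.trace = 1

/-- Superoperators in Lindblad form:
`ρ ↦ i[ρ, H] + ∑_j (L_j ρ L_j† - ½ {L_j† L_j, ρ})` with `H` Hermitian. -/
def IsLindbladian (T : Superop ι) : Prop :=
  ∃ (H : Matrix ι ι ℂ) (k : ℕ) (L : Fin k → Matrix ι ι ℂ), H.IsHermitian ∧
    ∀ ρ, T ρ = Complex.I • (ρ * H - H * ρ) +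
      ∑ j, (L j * ρ * (L j)ᴴ - (1 / 2 : ℂ) • ((L j)ᴴ * L j * ρ + ρ * ((L j)ᴴ * L j)))

/-- The evolution `T_t = exp(t 𝓛)` generated by `𝓛`, applied to `ρ`: the sum of the (always
convergent) exponential series `∑_n t^n/n! 𝓛^n ρ`. -/
def evolution (𝓛 : Superop ι) (t : ℝ) (ρ : Matrix ι ι ℂ) : Matrix ι ι ℂ :=
  ∑' n : ℕ, ((t : ℂ) ^ n / (n.factorial : ℂ)) • (𝓛 ^ n) ρ

end Norms

/-! ### The lattice `ℤ^D` -/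

/-- The sites of the lattice `ℤ^D`. -/
abbrev Site (D : ℕ) : Type := Fin D → ℤ

/-- The graph metric of the square lattice `ℤ^D`: the number of unit steps between two sites. -/
def siteDist {D : ℕ} (x y : Site D) : ℕ := ∑ i, (x i - y i).natAbs

/-- The ball `b_u(r)`. -/
def ball {D : ℕ} (u : Site D) (r : ℕ) : Finset (Site D) :=
  {y ∈ Finset.Icc (fun i => u i - r) (fun i => u i + r) | siteDist u y ≤ r}

theorem mem_ball {D : ℕ} {u y : Site D} {r : ℕ} : y ∈ ball u r ↔ siteDist u y ≤ r := by
  unfold ball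
  rw [Finset.mem_filter, and_iff_right_iff_imp, Finset.mem_Icc]
  intro h
  have key : ∀ i, (u i - y i).natAbs ≤ r := fun i =>
    (Finset.single_le_sum (f := fun i => (u i - y i).natAbs) (fun _ _ => Nat.zero_le _)
      (Finset.mem_univ i)).trans h
  constructor <;> intro i <;> have := key i <;> simp only <;> omega

/-- The diameter of a finite set of sites. -/
def diam {D : ℕ} (Z : Finset (Site D)) : ℕ := (Z ×ˢ Z).sup fun p => siteDist p.1 p.2

open Classical in
/-- `∂_d Λ = {x ∈ Λ | dist(x, Λᶜ) ≤ d}`. -/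
def bdry {D : ℕ} (d : ℕ) (Λ : Finset (Site D)) : Finset (Site D) :=
  {x ∈ Λ | ∃ y, y ∉ Λ ∧ siteDist x y ≤ d}

theorem bdry_subset {D : ℕ} (d : ℕ) (Λ : Finset (Site D)) : bdry d Λ ⊆ Λ := by
  classical
  exact Finset.filter_subset _ _

/-- The union of a finite collection of balls, each given by its centre and radius. -/
def region {D : ℕ} (𝓒 : Finset (Site D × ℕ)) : Finset (Site D) := 𝓒.biUnion fun c => ball c.1 c.2

theorem ball_subset_region {D : ℕ} {𝓒 : Finset (Site D × ℕ)} {c : Site D × ℕ} (hc : c ∈ 𝓒) :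
    ball c.1 c.2 ⊆ region 𝓒 :=
  Finset.subset_biUnion_of_mem (fun c : Site D × ℕ => ball c.1 c.2) hc

/-- The union of the balls in `𝓒` is a disjoint union in the lattice graph: different balls
neither meet nor touch, so that the balls are the connected components of `region 𝓒`. -/
def IsDisjointUnion {D : ℕ} (𝓒 : Finset (Site D × ℕ)) : Prop :=
  ∀ c ∈ 𝓒, ∀ c' ∈ 𝓒, c ≠ c' → ∀ x ∈ ball c.1 c.2, ∀ y ∈ ball c'.1 c'.2, 1 < siteDist x y

/-- `{x | dist(x, A) ≤ s}`. -/
def nbhd {D : ℕ} (A : Finset (Site D)) (s : ℕ) : Finset (Site D) := A.biUnion fun a => ball a s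

/-- `region 𝓒` is `A(s)`: a smallest disjoint union of balls that contains
`{x | dist(x, A) ≤ s}`. -/
def IsHull {D : ℕ} (A : Finset (Site D)) (s : ℕ) (𝓒 : Finset (Site D × ℕ)) : Prop :=
  IsDisjointUnion 𝓒 ∧ nbhd A s ⊆ region 𝓒 ∧
    ∀ 𝓒' : Finset (Site D × ℕ), IsDisjointUnion 𝓒' → nbhd A s ⊆ region 𝓒' →
      (region 𝓒).card ≤ (region 𝓒').card

/-! ### Local operators

The site `x` carries the Hilbert space `ℂ^(q x)`. -/

/-- The labels of the product basis of `𝓗_Λ = ⊗_{x ∈ Λ} ℂ^(q x)`. -/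
abbrev Cfg {D : ℕ} (q : Site D → ℕ) (Λ : Finset (Site D)) : Type := (x : Λ) → Fin (q x)

/-- The operators on `𝓗_Λ`. -/
abbrev Op {D : ℕ} (q : Site D → ℕ) (Λ : Finset (Site D)) : Type :=
  Matrix (Cfg q Λ) (Cfg q Λ) ℂ

section Local

variable {D : ℕ} {q : Site D → ℕ} {Z Λ : Finset (Site D)}

/-- Restriction of a basis label from `Λ` to `Z ⊆ Λ`. -/
def restrict (h : Z ⊆ Λ) (σ : Cfg q Λ) : Cfg q Z := fun x => σ ⟨x.1, h x.2⟩

/-- Replacement of the part of `σ` in `Z` by `a`. -/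
def replace (σ : Cfg q Λ) (a : Cfg q Z) : Cfg q Λ := fun x =>
  if hx : x.1 ∈ Z then a ⟨x.1, hx⟩ else σ x

/-- The superoperator `T ⊗ id` on `𝓐_Λ = 𝓐_Z ⊗ 𝓐_{Λ ∖ Z}`, for `T` on `𝓐_Z`. -/
def extend (h : Z ⊆ Λ) (T : Superop (Cfg q Z)) : Superop (Cfg q Λ) where
  toFun X := Matrix.of fun σ σ' =>
    T (Matrix.of fun a b => X (replace σ a) (replace σ' b)) (restrict h σ) (restrict h σ')
  map_add' X Y := by
    ext σ σ'
    exact congrFun (congrFun (map_add T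
      (Matrix.of fun a b => X (replace σ a) (replace σ' b))
      (Matrix.of fun a b => Y (replace σ a) (replace σ' b))) _) _
  map_smul' c X := by
    ext σ σ'
    exact congrFun (congrFun (map_smul T c
      (Matrix.of fun a b => X (replace σ a) (replace σ' b))) _) _

/-- The product `ρ ⊗ τ` on `Λ` of an operator on `Z ⊆ Λ` and an operator on `Λ ∖ Z`. -/
def tensor (h : Z ⊆ Λ) (ρ : Op q Z) (τ : Op q (Λ \ Z)) : Op q Λ :=
  Matrix.of fun σ σ' => ρ (restrict h σ) (restrict h σ') *
    τ (restrict Finset.sdiff_subset σ) (restrict Finset.sdiff_subset σ')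

end Local

/-! ### Uniform families -/

/-- A uniform family of Lindbladians on `ℤ^D`: local terms `𝓜_Z`, supported on the finite sets
`Z ⊂ ℤ^D`, and for each ball `b_u(N)` a boundary condition with terms `𝓑_d`, `d ≥ 1`, supported on
`∂_d b_u(N)`. As `∂_d b_u(N) = b_u(N)` for `d ≥ N + 1`, the terms beyond `N` can be
collected in `𝓑_{N+1}`; only the values `1 ≤ d ≤ N + 1` are used. -/
structure UniformFamily (D : ℕ) (q : Site D → ℕ) where
  bulk : (Z : Finset (Site D)) → Superop (Cfg q Z)
  bulk_lindbladian : ∀ Z, IsLindbladian (bulk Z)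
  bd : (u : Site D) → (N d : ℕ) → Superop (Cfg q (bdry d (ball u N)))
  bd_lindbladian : ∀ u N d, IsLindbladian (bd u N d)

namespace UniformFamily

variable {D : ℕ} {q : Site D → ℕ} (F : UniformFamily D q)

/-- `∑_{Z ⊆ W} 𝓜_Z`, acting on `𝓐_Λ`, for `W ⊆ Λ`. -/
def bulkGen {W Λ : Finset (Site D)} (h : W ⊆ Λ) : Superop (Cfg q Λ) :=
  ∑ Z : W.powerset, extend ((Finset.mem_powerset.1 Z.2).trans h) (F.bulk Z)

/-- `𝓑_d^{∂b}` for the component `b = b_u(N)` of `Λ = region 𝓒`, acting on `𝓐_Λ`. -/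
def bdTerm {𝓒 : Finset (Site D × ℕ)} (c : 𝓒) (d : ℕ) : Superop (Cfg q (region 𝓒)) :=
  extend ((bdry_subset d _).trans (ball_subset_region c.2)) (F.bd c.1.1 c.1.2 d)

/-- The closed boundary generator `𝓛^{Λ̄} = ∑_{Z ⊆ Λ} 𝓜_Z + ∑_d 𝓑_d^{∂Λ}` of `Λ = region 𝓒`, with
the boundary conditions of all components of `Λ`. -/
def closedGen (𝓒 : Finset (Site D × ℕ)) : Superop (Cfg q (region 𝓒)) :=
  F.bulkGen (Finset.Subset.refl (region 𝓒)) +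
    ∑ c : 𝓒, ∑ d ∈ Finset.Icc 1 (c.1.2 + 1), F.bdTerm c d

/-- `𝓛^{B̄ ∖ A} = ∑_{Z ⊆ B ∖ A} 𝓜_Z + ∑_{d ≤ k} 𝓑_d^{∂B}` on `B = region 𝓒`. -/
def cutGen (𝓒 : Finset (Site D × ℕ)) (A : Finset (Site D)) (k : ℕ) :
    Superop (Cfg q (region 𝓒)) :=
  F.bulkGen (W := region 𝓒 \ A) Finset.sdiff_subset +
    ∑ c : 𝓒, ∑ d ∈ Finset.Icc 1 (c.1.2 + 1) with d ≤ k, F.bdTerm c d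

/-- `ρ` is a fixed state of the evolution with closed boundary on `region 𝓒`. -/
def IsFixedState (𝓒 : Finset (Site D × ℕ)) (ρ : Op q (region 𝓒)) : Prop :=
  IsState ρ ∧ ∀ t : ℝ, 0 ≤ t → evolution (F.closedGen 𝓒) t ρ = ρ

/-- Frustration freeness: all local terms inside `Λ` annihilate every fixed state of the closed
boundary evolution on `Λ`, for all disjoint unions `Λ` of balls. -/
def FrustrationFree : Prop :=
  ∀ 𝓒 : Finset (Site D × ℕ), IsDisjointUnion 𝓒 → ∀ ρ : Op q (region 𝓒), F.IsFixedState 𝓒 ρ →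
    ∀ (Z : Finset (Site D)) (hZ : Z ⊆ region 𝓒), extend hZ (F.bulk Z) ρ = 0

/-- The Lieb-Robinson assumptions, with growth function `ν` and velocity `v`. -/
structure LiebRobinson (ν : ℕ → ℝ) (v : ℝ) : Prop where
  nonneg : 0 ≤ v
  pos : ∀ r, 0 < ν r
  mono : Monotone ν
  submul : ∀ r s, ν (r + s) ≤ ν r * ν s
  /-- `sup_x ∑_{Z ∋ x} ‖𝓜_Z‖_⋄ |Z| ν(diam Z) ≤ v` -/
  bulk_decay : ∀ x : Site D,
    ∑' Z : {Z : Finset (Site D) // x ∈ Z},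
      diamondNorm (F.bulk Z) * (Z.1.card : ℝ≥0∞) * ENNReal.ofReal (ν (diam Z.1)) ≤
        ENNReal.ofReal v
  /-- `sup_x sup_r ν(r) ∑_{d ≥ r} ‖𝓑_d^{∂b_x(N)}‖_⋄ ≤ poly(N)` -/
  bd_decay : ∃ P : Polynomial ℝ, ∀ (x : Site D) (N r : ℕ), 1 ≤ r →
    ENNReal.ofReal (ν r) * ∑ d ∈ Finset.Icc r (N + 1), diamondNorm (F.bd x N d) ≤
      ENNReal.ofReal (P.eval (N : ℝ))

end UniformFamily

end

end OpenLattice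

open OpenLattice

/-!
By frustration freeness `𝓜_Z` annihilates `ρ ⊗ τ` for all `Z ⊆ A(m)`, so initially only the bulk
terms that reach out of `A(m)` act. Let `u` be the evolution of `ρ ⊗ τ` with closed boundary and
give the site `x` the weight `w(x) = ν(depth of x in the m-neighbourhood of A)`. Since `𝓜_Z`
commutes with the terms of the generator supported away from `Z`, and these generate a contraction
semigroup, `‖𝓜_Z(u)‖₁` grows only through the terms that meet `Z`. The decay assumptions turn this
into a Grönwall inequality for `max_x w(x) ∑_{Z ∋ x} ‖𝓜_Z(u)‖₁`, which therefore stays below a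
polynomial in `m` times `e^{vt}`; on `A`, where `w ≥ ν(m)`, the terms with `Z ∩ A ≠ ∅` are thus of
order `e^{vt} / ν(m)`. The cut generator only lacks these terms and the boundary terms `𝓑_d` with
`d > m + 1`, which are of order `1 / ν(m)`. As its evolution is a contraction, the two evolutions
differ by at most the time integral of these bounds.
-/

namespace OpenLattice

open Filter Set
open scoped Topology

/-! ### The trace norm -/

section TraceNorm

variable {ι κ α : Type}

/-- The `k`-th column of `A`, as a vector of the Euclidean space `ℂ^ι`. -/
noncomputable def colVec (A : Matrix ι α ℂ) (k : α) : EuclideanSpace ℂ ι :=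
  WithLp.toLp 2 (A.col k)

theorem colVec_zero (k : α) : colVec (0 : Matrix ι α ℂ) k = 0 := rfl

theorem colVec_smul (c : ℂ) (A : Matrix ι α ℂ) (k : α) : colVec (c • A) k = c • colVec A k := rfl

variable [Fintype ι] [Fintype κ]

theorem conjTranspose_mul_apply_eq_inner (A B : Matrix ι α ℂ) (k l : α) :
    (Aᴴ * B) k l = inner ℂ (colVec A k) (colVec B l) := by
  rw [EuclideanSpace.inner_eq_star_dotProduct, dotProduct_comm]
  rfl

theorem conjTranspose_mul_self_apply_self (A : Matrix ι α ℂ) (k : α) :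
    (Aᴴ * A) k k = ((‖colVec A k‖ ^ 2 : ℝ) : ℂ) := by
  rw [conjTranspose_mul_apply_eq_inner, inner_self_eq_norm_sq_to_K]
  simp

theorem sum_norm_colVec_mul_sq_le {β : Type} [Fintype α] [Finite β] [DecidableEq ι] {c : ℝ}
    {E : α → Matrix κ ι ℂ} (hE : (c • (1 : Matrix ι ι ℂ) - ∑ a, (E a)ᴴ * E a).PosSemidef)
    (Y : Matrix ι β ℂ) (k : β) :
    ∑ a, ‖colVec (E a * Y) k‖ ^ 2 ≤ c * ‖colVec Y k‖ ^ 2 := by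
  have := Fintype.ofFinite β
  have expand : Yᴴ * (c • (1 : Matrix ι ι ℂ) - ∑ a, (E a)ᴴ * E a) * Y =
      c • (Yᴴ * Y) - ∑ a, (E a * Y)ᴴ * (E a * Y) := by
    simp only [Matrix.mul_sub, Matrix.sub_mul, Matrix.mul_sum, Matrix.sum_mul, Matrix.mul_smul,
      Matrix.smul_mul, Matrix.mul_one, Matrix.conjTranspose_mul, Matrix.mul_assoc]
  have nonneg := (hE.conjTranspose_mul_mul_same Y).diag_nonneg (i := k)
  rw [expand, Matrix.sub_apply, Matrix.smul_apply, Matrix.sum_apply] at nonneg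
  simp only [conjTranspose_mul_self_apply_self] at nonneg
  rw [Complex.real_smul] at nonneg
  exact_mod_cast sub_nonneg.1 nonneg

variable [DecidableEq ι]

theorem traceNorm_nonneg (X : Matrix ι ι ℂ) : 0 ≤ traceNorm X :=
  Finset.sum_nonneg fun _ _ => Real.sqrt_nonneg _

theorem exists_orthogonal_mul_unitary (X : Matrix ι ι ℂ) :
    ∃ (U : Matrix ι ι ℂ) (s : ι → ℝ), Uᴴ * U = 1 ∧ U * Uᴴ = 1 ∧ (∀ i, 0 ≤ s i) ∧
      (X * U)ᴴ * (X * U) = Matrix.diagonal (fun i => (s i : ℂ) ^ 2) ∧ traceNorm X = ∑ i, s i := by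
  set hX := Matrix.isHermitian_conjTranspose_mul_self X
  set U : Matrix ι ι ℂ := (hX.eigenvectorUnitary : Matrix ι ι ℂ)
  have UU : Uᴴ * U = 1 := Unitary.coe_star_mul_self hX.eigenvectorUnitary
  have spectral : Xᴴ * X = U * Matrix.diagonal (fun i => (hX.eigenvalues i : ℂ)) * Uᴴ := by
    conv_lhs => rw [hX.spectral_theorem, Unitary.conjStarAlgAut_apply]
    rfl
  refine ⟨U, fun i => √(hX.eigenvalues i), UU, Unitary.coe_mul_star_self hX.eigenvectorUnitary,
    fun i => Real.sqrt_nonneg _, ?_, rfl⟩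
  calc (X * U)ᴴ * (X * U) = Uᴴ * (Xᴴ * X) * U := by
        simp only [Matrix.conjTranspose_mul, Matrix.mul_assoc]
    _ = Uᴴ * (U * Matrix.diagonal (fun i => (hX.eigenvalues i : ℂ)) * Uᴴ) * U := by rw [← spectral]
    _ = Uᴴ * U * Matrix.diagonal (fun i => (hX.eigenvalues i : ℂ)) * (Uᴴ * U) := by
        simp only [Matrix.mul_assoc]
    _ = Matrix.diagonal (fun i => ((√(hX.eigenvalues i) : ℝ) : ℂ) ^ 2) := by
        simp only [UU, Matrix.one_mul, Matrix.mul_one, ← Complex.ofReal_pow,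
          Real.sq_sqrt ((Matrix.posSemidef_conjTranspose_mul_self X).eigenvalues_nonneg _)]

theorem exists_mul_conjTranspose_eq (X : Matrix ι ι ℂ) :
    ∃ Y V : Matrix ι ι ℂ, X = Y * Vᴴ ∧ traceNorm X = ∑ k, ‖colVec Y k‖ * ‖colVec V k‖ := by
  obtain ⟨U, s, UU, UU', s_nonneg, orthogonal, trace_norm⟩ := exists_orthogonal_mul_unitary X
  refine ⟨X * U, U, by rw [Matrix.mul_assoc, UU', Matrix.mul_one], ?_⟩
  have norm_U : ∀ k, ‖colVec U k‖ = 1 := fun k => by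
    have h := conjTranspose_mul_self_apply_self U k
    rw [UU, Matrix.one_apply_eq] at h
    exact (pow_eq_one_iff_of_nonneg (norm_nonneg _) two_ne_zero).1 (by exact_mod_cast h.symm)
  have norm_XU : ∀ k, ‖colVec (X * U) k‖ = s k := fun k => by
    have h := conjTranspose_mul_self_apply_self (X * U) k
    rw [orthogonal, Matrix.diagonal_apply_eq] at h
    exact ((sq_eq_sq₀ (s_nonneg k) (norm_nonneg _)).1 (by exact_mod_cast h)).symm
  simp only [norm_U, norm_XU, mul_one, trace_norm]

open scoped MatrixOrder in
/-- `W` is the adjoint of the partial isometry in the polar decomposition of `X`. -/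
theorem exists_trace_mul_eq_traceNorm (X : Matrix ι ι ℂ) :
    ∃ W : Matrix ι ι ℂ, (1 - Wᴴ * W).PosSemidef ∧ (W * X).trace = traceNorm X := by
  obtain ⟨U, s, UU, -, -, orthogonal, trace_norm⟩ := exists_orthogonal_mul_unitary X
  set Y := X * U
  set R : Matrix ι ι ℂ := Matrix.diagonal fun i => ((s i)⁻¹ : ℂ)
  have R_adjoint : Rᴴ = R := by simp [R, Matrix.diagonal_conjTranspose, Pi.star_def]
  refine ⟨U * R * Yᴴ, ?_, ?_⟩
  · set P := (U * R * Yᴴ)ᴴ * (U * R * Yᴴ)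
    have P_eq : P = Y * (R * R) * Yᴴ := by
      calc P = Y * R * (Uᴴ * U) * R * Yᴴ := by
            simp only [P, Matrix.conjTranspose_mul, Matrix.conjTranspose_conjTranspose, R_adjoint,
              Matrix.mul_assoc]
        _ = Y * (R * R) * Yᴴ := by simp only [UU, Matrix.mul_one, Matrix.mul_assoc]
    have R_sq_inverse : R * R * (Yᴴ * Y) * (R * R) = R * R := by
      rw [orthogonal]
      simp only [R, Matrix.diagonal_mul_diagonal]
      congr 1
      ext i
      by_cases h : (s i : ℂ) = 0
      · simp [h]
      · field_simp
    have P_idempotent : P * P = P := by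
      calc P * P = Y * (R * R * (Yᴴ * Y) * (R * R)) * Yᴴ := by
            simp only [P_eq, Matrix.mul_assoc]
        _ = P := by rw [R_sq_inverse, P_eq]
    exact Matrix.nonneg_iff_posSemidef.1 (IsStarProjection.one_sub_nonneg
      ⟨P_idempotent, Matrix.isHermitian_conjTranspose_mul_self (U * R * Yᴴ)⟩)
  · calc (U * R * Yᴴ * X).trace = (R * (Yᴴ * Y)).trace := by
          rw [Matrix.mul_assoc, Matrix.mul_assoc, Matrix.trace_mul_comm]
          simp only [Y, Matrix.mul_assoc]
      _ = ∑ i, (s i : ℂ) := by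
          rw [orthogonal, Matrix.diagonal_mul_diagonal, Matrix.trace_diagonal]
          refine Finset.sum_congr rfl fun i _ => ?_
          by_cases h : (s i : ℂ) = 0
          · simp [h]
          · field_simp
      _ = traceNorm X := by rw [trace_norm, Complex.ofReal_sum]

theorem norm_trace_mul_le_sum [Fintype α] {W : Matrix ι ι ℂ} (hW : (1 - Wᴴ * W).PosSemidef)
    (Y V : Matrix ι α ℂ) :
    ‖(W * (Y * Vᴴ)).trace‖ ≤ ∑ k, ‖colVec Y k‖ * ‖colVec V k‖ := by
  rw [← Matrix.mul_assoc, Matrix.trace_mul_comm]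
  refine norm_sum_le_of_le _ fun k _ => ?_
  have contraction : ‖colVec (W * Y) k‖ ≤ ‖colVec Y k‖ := by
    refine abs_le_of_sq_le_sq' ?_ (norm_nonneg _) |>.2
    simpa using sum_norm_colVec_mul_sq_le (α := Unit) (c := 1) (E := fun _ => W) (by simpa using hW)
      Y k
  calc ‖(Vᴴ * (W * Y)) k k‖ ≤ ‖colVec V k‖ * ‖colVec (W * Y) k‖ := by
        rw [conjTranspose_mul_apply_eq_inner]
        exact norm_inner_le_norm _ _
    _ ≤ ‖colVec Y k‖ * ‖colVec V k‖ := by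
        rw [mul_comm]
        gcongr

theorem norm_trace_mul_le_traceNorm {W : Matrix ι ι ℂ} (hW : (1 - Wᴴ * W).PosSemidef)
    (X : Matrix ι ι ℂ) : ‖(W * X).trace‖ ≤ traceNorm X := by
  obtain ⟨Y, V, rfl, trace_norm⟩ := exists_mul_conjTranspose_eq X
  exact trace_norm ▸ norm_trace_mul_le_sum hW Y V

theorem traceNorm_mul_conjTranspose_le [Fintype α] (Y V : Matrix ι α ℂ) :
    traceNorm (Y * Vᴴ) ≤ ∑ k, ‖colVec Y k‖ * ‖colVec V k‖ := by
  obtain ⟨W, hW, trace_eq⟩ := exists_trace_mul_eq_traceNorm (Y * Vᴴ)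
  calc traceNorm (Y * Vᴴ) = ‖(W * (Y * Vᴴ)).trace‖ := by
        rw [trace_eq, Complex.norm_real, Real.norm_of_nonneg (traceNorm_nonneg _)]
    _ ≤ _ := norm_trace_mul_le_sum hW Y V

theorem traceNorm_add_le (X Y : Matrix ι ι ℂ) :
    traceNorm (X + Y) ≤ traceNorm X + traceNorm Y := by
  obtain ⟨W, hW, trace_eq⟩ := exists_trace_mul_eq_traceNorm (X + Y)
  calc traceNorm (X + Y) = ‖(W * X).trace + (W * Y).trace‖ := by
        rw [← Matrix.trace_add, ← Matrix.mul_add, trace_eq, Complex.norm_real,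
          Real.norm_of_nonneg (traceNorm_nonneg _)]
    _ ≤ traceNorm X + traceNorm Y := (norm_add_le _ _).trans <|
        add_le_add (norm_trace_mul_le_traceNorm hW X) (norm_trace_mul_le_traceNorm hW Y)

theorem traceNorm_zero : traceNorm (0 : Matrix ι ι ℂ) = 0 := by
  refine le_antisymm ?_ (traceNorm_nonneg 0)
  simpa [colVec_zero] using traceNorm_mul_conjTranspose_le (0 : Matrix ι ι ℂ) 0

theorem eq_zero_of_traceNorm_eq_zero {X : Matrix ι ι ℂ} (hX : traceNorm X = 0) : X = 0 := by
  obtain ⟨U, s, -, UU', s_nonneg, orthogonal, trace_norm⟩ := exists_orthogonal_mul_unitary X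
  have s_zero : ∀ i, s i = 0 := fun i =>
    (Finset.sum_eq_zero_iff_of_nonneg fun j _ => s_nonneg j).1 (trace_norm.symm.trans hX) i
      (Finset.mem_univ i)
  have XU_zero : X * U = 0 := by
    rw [← Matrix.conjTranspose_mul_self_eq_zero, orthogonal]
    simp [s_zero]
  rw [← Matrix.mul_one X, ← UU', ← Matrix.mul_assoc, XU_zero, Matrix.zero_mul]

theorem traceNorm_smul_le (c : ℂ) (X : Matrix ι ι ℂ) : traceNorm (c • X) ≤ ‖c‖ * traceNorm X := by
  obtain ⟨Y, V, rfl, trace_norm⟩ := exists_mul_conjTranspose_eq X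
  rw [trace_norm, Finset.mul_sum, ← Matrix.smul_mul]
  refine (traceNorm_mul_conjTranspose_le _ _).trans_eq (Finset.sum_congr rfl fun k _ => ?_)
  rw [colVec_smul, norm_smul, mul_assoc]

theorem traceNorm_smul {𝕜 : Type*} [NormedField 𝕜] [NormedAlgebra 𝕜 ℂ] (c : 𝕜)
    (X : Matrix ι ι ℂ) : traceNorm (c • X) = ‖c‖ * traceNorm X := by
  rw [← algebraMap_smul ℂ c X, ← norm_algebraMap' ℂ c]
  exact (Seminorm.ofSMulLE traceNorm traceNorm_zero traceNorm_add_le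
    traceNorm_smul_le).smul' (algebraMap 𝕜 ℂ c) X

open scoped Matrix.Norms.L2Operator MatrixOrder in
theorem IsState.traceNorm_le_one {ρ : Matrix ι ι ℂ} (hρ : IsState ρ) : traceNorm ρ ≤ 1 := by
  obtain ⟨C, rfl⟩ := CStarAlgebra.nonneg_iff_eq_star_mul_self.1 hρ.1.nonneg
  rw [Matrix.star_eq_conjTranspose] at *
  have frobenius : ∑ k, ‖colVec Cᴴ k‖ ^ 2 = 1 := by
    have h := hρ.2
    rw [Matrix.trace_mul_comm, Matrix.trace] at h
    nth_rw 1 [← Matrix.conjTranspose_conjTranspose C] at h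
    simp only [Matrix.diag, conjTranspose_mul_self_apply_self] at h
    exact_mod_cast h
  simpa only [Matrix.conjTranspose_conjTranspose, ← sq, frobenius] using
    traceNorm_mul_conjTranspose_le Cᴴ Cᴴ

theorem traceNorm_eq_sum_roots (X : Matrix ι ι ℂ) :
    traceNorm X = ((Xᴴ * X).charpoly.roots.map fun z => √z.re).sum := by
  rw [(Matrix.isHermitian_conjTranspose_mul_self X).roots_charpoly_eq_eigenvalues, Multiset.map_map]
  rfl

theorem traceNorm_submatrix_equiv [DecidableEq κ] (e : κ ≃ ι) (X : Matrix ι ι ℂ) :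
    traceNorm (X.submatrix e e) = traceNorm X := by
  have h : (X.submatrix e e)ᴴ * X.submatrix e e = Matrix.reindex e.symm e.symm (Xᴴ * X) := by
    rw [Matrix.conjTranspose_submatrix, Matrix.submatrix_mul_equiv]
    rfl
  rw [traceNorm_eq_sum_roots, traceNorm_eq_sum_roots, h, Matrix.charpoly_reindex]

end TraceNorm

section NormedSpace

variable {ι : Type} [Fintype ι] [DecidableEq ι]

theorem traceNorm_core : @NormedSpace.Core ℂ (Matrix ι ι ℂ) _ _ _ ⟨traceNorm⟩ :=
  letI : Norm (Matrix ι ι ℂ) := ⟨traceNorm⟩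
  { norm_nonneg := traceNorm_nonneg
    norm_smul := traceNorm_smul
    norm_triangle := traceNorm_add_le
    norm_eq_zero_iff := fun _ => ⟨eq_zero_of_traceNorm_eq_zero, fun h => h ▸ traceNorm_zero⟩ }

/-- The normed group of matrices with the trace norm; its topology is the usual one. -/
@[reducible] noncomputable def traceNormedAddCommGroup : NormedAddCommGroup (Matrix ι ι ℂ) :=
  letI : Norm (Matrix ι ι ℂ) := ⟨traceNorm⟩
  .ofCoreReplaceTopology traceNorm_core <| by
    have usual := isModuleTopologyOfFiniteDimensional (𝕜 := ℂ) (E := Matrix ι ι ℂ)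
    let := NormedAddCommGroup.ofCore (traceNorm_core (ι := ι))
    let := NormedSpace.ofCore (traceNorm_core (ι := ι))
    let T : TopologicalSpace (Matrix ι ι ℂ) := PseudoEMetricSpace.toUniformSpace.toTopologicalSpace
    have trace := @isModuleTopologyOfFiniteDimensional ℂ _ (Matrix ι ι ℂ) _ _ T inferInstance
      inferInstance inferInstance inferInstance inferInstance
    exact usual.eq_moduleTopology'.trans trace.eq_moduleTopology'.symm

attribute [local instance] traceNormedAddCommGroup

/-- The trace norm makes the matrices a normed space over `ℝ` and over `ℂ`. -/
@[reducible] noncomputable def traceNormedSpace {𝕜 : Type*} [NormedField 𝕜] [NormedAlgebra 𝕜 ℂ] :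
    NormedSpace 𝕜 (Matrix ι ι ℂ) where
  norm_smul_le c X := (traceNorm_smul c X).le

attribute [local instance] traceNormedSpace

theorem norm_sum_conj_le {α : Type} [Fintype α] {c : ℝ} (hc : 0 ≤ c) {E : α → Matrix ι ι ℂ}
    (hE : (c • (1 : Matrix ι ι ℂ) - ∑ a, (E a)ᴴ * E a).PosSemidef) (X : Matrix ι ι ℂ) :
    ‖∑ a, E a * X * (E a)ᴴ‖ ≤ c * ‖X‖ := by
  obtain ⟨Y, V, rfl, norm_eq⟩ := exists_mul_conjTranspose_eq X
  calc ‖∑ a, E a * (Y * Vᴴ) * (E a)ᴴ‖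
      ≤ ∑ a, ‖E a * Y * (E a * V)ᴴ‖ := by
        refine norm_sum_le_of_le _ fun a _ => le_of_eq ?_
        simp only [Matrix.conjTranspose_mul, Matrix.mul_assoc]
    _ ≤ ∑ a, ∑ k, ‖colVec (E a * Y) k‖ * ‖colVec (E a * V) k‖ :=
        Finset.sum_le_sum fun a _ => traceNorm_mul_conjTranspose_le _ _
    _ = ∑ k, ∑ a, ‖colVec (E a * Y) k‖ * ‖colVec (E a * V) k‖ := Finset.sum_comm
    _ ≤ ∑ k, √(c * ‖colVec Y k‖ ^ 2) * √(c * ‖colVec V k‖ ^ 2) :=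
        Finset.sum_le_sum fun k _ => (Real.sum_mul_le_sqrt_mul_sqrt _ _ _).trans <| by
          gcongr <;> exact sum_norm_colVec_mul_sq_le hE _ k
    _ = ∑ k, c * (‖colVec Y k‖ * ‖colVec V k‖) := Finset.sum_congr rfl fun k _ => by
        rw [Real.sqrt_mul hc, Real.sqrt_mul hc, Real.sqrt_sq (norm_nonneg _),
          Real.sqrt_sq (norm_nonneg _), mul_mul_mul_comm, Real.mul_self_sqrt hc]
    _ = c * ‖Y * Vᴴ‖ := by rw [← Finset.mul_sum, ← norm_eq]; rfl

end NormedSpace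

/-! ### Dissipative maps and differential inequalities -/

section Dissipative

variable {𝕜 E : Type*} [Semiring 𝕜] [NormedAddCommGroup E] [NormedSpace ℝ E] [Module 𝕜 E]

/-- The generators of contraction semigroups, for which `1 + s T` is a contraction up to second
order in the time `s ≥ 0`. -/
def IsDissipative (T : Module.End 𝕜 E) : Prop :=
  ∀ x, ∃ C, ∀ s : ℝ, 0 ≤ s → ‖x + s • T x‖ ≤ ‖x‖ + C * s ^ 2

theorem isDissipative_zero : IsDissipative (0 : Module.End 𝕜 E) := fun x => ⟨0, by simp⟩

theorem IsDissipative.add {T T' : Module.End 𝕜 E} (hT : IsDissipative T)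
    (hT' : IsDissipative T') : IsDissipative (T + T') := by
  intro x
  obtain ⟨C, hC⟩ := hT x
  obtain ⟨C', hC'⟩ := hT' x
  refine ⟨2 * C + 2 * C', fun s hs => ?_⟩
  calc ‖x + s • (T + T') x‖
      = ‖(1 / 2 : ℝ) • (x + (2 * s) • T x) + (1 / 2 : ℝ) • (x + (2 * s) • T' x)‖ := by
        rw [LinearMap.add_apply]
        congr 1
        module
    _ ≤ 1 / 2 * ‖x + (2 * s) • T x‖ + 1 / 2 * ‖x + (2 * s) • T' x‖ := by
        refine (norm_add_le _ _).trans_eq ?_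
        simp only [norm_smul, Real.norm_of_nonneg (one_half_pos (α := ℝ)).le]
    _ ≤ 1 / 2 * (‖x‖ + C * (2 * s) ^ 2) + 1 / 2 * (‖x‖ + C' * (2 * s) ^ 2) := by
        gcongr
        exacts [hC (2 * s) (by positivity), hC' (2 * s) (by positivity)]
    _ = ‖x‖ + (2 * C + 2 * C') * s ^ 2 := by ring

theorem isDissipative_sum {α : Type*} {s : Finset α} {T : α → Module.End 𝕜 E}
    (hT : ∀ a ∈ s, IsDissipative (T a)) : IsDissipative (∑ a ∈ s, T a) :=
  Finset.sum_induction _ _ (fun _ _ => IsDissipative.add) isDissipative_zero hT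

theorem IsDissipative.eventually_slope_norm_lt {G : Module.End 𝕜 E} (hG : IsDissipative G)
    {x : ℝ → E} {w : E} {s r : ℝ} (hx : HasDerivAt x (G (x s) + w) s) (hr : ‖w‖ < r) :
    ∀ᶠ z in 𝓝[>] s, slope (fun t => ‖x t‖) s z < r := by
  obtain ⟨C, hC⟩ := hG (x s)
  set ε := (r - ‖w‖) / 2 with hε
  have ε_pos : 0 < ε := half_pos (sub_pos.2 hr)
  have first_order := nhdsWithin_le_nhds (s := Ioi s) <|
    (hasDerivAt_iff_isLittleO.1 hx).def ε_pos
  have second_order : ∀ᶠ z in 𝓝[>] s, C * (z - s) < ε := by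
    have h : Tendsto (fun z => C * (z - s)) (𝓝 s) (𝓝 (C * (s - s))) :=
      Continuous.tendsto (by fun_prop) s
    rw [sub_self, mul_zero] at h
    exact nhdsWithin_le_nhds (h.eventually (gt_mem_nhds ε_pos))
  filter_upwards [first_order, second_order, self_mem_nhdsWithin] with z h₁ h₂ hz
  have h_pos : 0 < z - s := sub_pos.2 hz
  rw [Real.norm_of_nonneg h_pos.le] at h₁
  rw [slope_def_field, div_lt_iff₀ h_pos, sub_lt_iff_lt_add']
  calc ‖x z‖ = ‖x s + (z - s) • G (x s) + (z - s) • w +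
        (x z - x s - (z - s) • (G (x s) + w))‖ := by
        congr 1
        module
    _ ≤ ‖x s‖ + C * (z - s) ^ 2 + (z - s) * ‖w‖ + ε * (z - s) := by
        refine norm_add₃_le.trans ?_
        gcongr
        · exact hC _ h_pos.le
        · rw [norm_smul, Real.norm_of_nonneg h_pos.le]
    _ = ‖x s‖ + (C * (z - s) + ‖w‖ + ε) * (z - s) := by ring
    _ < ‖x s‖ + r * (z - s) := by
        gcongr
        linarith

theorem IsDissipative.norm_le_of_hasDerivAt {G : Module.End 𝕜 E} (hG : IsDissipative G)
    {x w : ℝ → E} {B b : ℝ → ℝ} (hx : ∀ t, HasDerivAt x (G (x t) + w t) t)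
    (hB : ∀ t, HasDerivAt B (b t) t) (hw : ∀ t, 0 ≤ t → ‖w t‖ ≤ b t) (h0 : ‖x 0‖ ≤ B 0)
    {t : ℝ} (ht : 0 ≤ t) : ‖x t‖ ≤ B t := by
  have x_cont : Continuous x := continuous_iff_continuousAt.2 fun t => (hx t).continuousAt
  have B_cont : Continuous B := continuous_iff_continuousAt.2 fun t => (hB t).continuousAt
  exact image_le_of_liminf_slope_right_le_deriv_boundary x_cont.norm.continuousOn h0
    B_cont.continuousOn (fun s _ => (hB s).hasDerivWithinAt)
    (fun s hs r hr => (hG.eventually_slope_norm_lt (hx s) ((hw s hs.1).trans_lt hr)).frequently)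
    (right_mem_Icc.2 ht)

theorem IsDissipative.norm_sub_le_of_hasDerivAt {G H : Module.End 𝕜 E} (hG : IsDissipative G)
    {x y : ℝ → E} {B b : ℝ → ℝ} (hx : ∀ t, HasDerivAt x (G (x t)) t)
    (hy : ∀ t, HasDerivAt y (H (y t)) t) (h0 : x 0 = y 0) (hB : ∀ t, HasDerivAt B (b t) t)
    (hB0 : 0 ≤ B 0) (hGH : ∀ t, 0 ≤ t → ‖(G - H) (y t)‖ ≤ b t) {t : ℝ} (ht : 0 ≤ t) :
    ‖x t - y t‖ ≤ B t := by
  refine hG.norm_le_of_hasDerivAt (x := fun t => x t - y t) (w := fun t => (G - H) (y t))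
    (fun t => ?_) hB hGH (by simpa [h0] using hB0) ht
  refine ((hx t).fun_sub (hy t)).congr_deriv ?_
  rw [map_sub, LinearMap.sub_apply]
  abel

end Dissipative

section Evolution

variable {E : Type*} [NormedAddCommGroup E] [NormedSpace ℂ E] [FiniteDimensional ℂ E]

theorem tsum_exp_smul_pow_apply (T : Module.End ℂ E) (c : ℂ) (x : E) :
    ∑' n : ℕ, (c ^ n / (n.factorial : ℂ)) • (T ^ n) x =
      NormedSpace.exp (c • LinearMap.toContinuousLinearMap T) x := by
  have := FiniteDimensional.complete ℂ E
  have pow_apply : ∀ n y, (LinearMap.toContinuousLinearMap T ^ n) y = (T ^ n) y := fun n => by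
    induction n with
    | zero => exact fun y => rfl
    | succ n ih =>
      intro y
      rw [pow_succ, pow_succ]
      exact ih _
  have series := (NormedSpace.exp_series_hasSum_exp' (𝕂 := ℂ)
    (c • LinearMap.toContinuousLinearMap T)).mapL (ContinuousLinearMap.apply ℂ E x)
  refine Eq.trans (tsum_congr fun n => ?_) series.tsum_eq
  simp only [ContinuousLinearMap.apply_apply, smul_pow, smul_apply, smul_smul, pow_apply]
  rw [div_eq_inv_mul]

variable [NormedSpace ℝ E] [IsScalarTower ℝ ℂ E]

theorem hasDerivAt_linearMap_comp (M : Module.End ℂ E) {u : ℝ → E} {u' : E} {t : ℝ}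
    (hu : HasDerivAt u u' t) : HasDerivAt (fun s => M (u s)) (M u') t :=
  ((LinearMap.toContinuousLinearMap M).restrictScalars ℝ).hasFDerivAt.comp_hasDerivAt t hu

theorem hasDerivAt_tsum_exp_smul_pow_apply (T : Module.End ℂ E) (x : E) (t : ℝ) :
    HasDerivAt (fun s : ℝ => ∑' n : ℕ, ((s : ℂ) ^ n / (n.factorial : ℂ)) • (T ^ n) x)
      (T (∑' n : ℕ, ((t : ℂ) ^ n / (n.factorial : ℂ)) • (T ^ n) x)) t := by
  have := FiniteDimensional.complete ℂ E
  simp only [tsum_exp_smul_pow_apply]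
  have deriv_exp := (hasDerivAt_exp_smul_const' (LinearMap.toContinuousLinearMap T) (t : ℂ)).scomp t
    Complex.ofRealCLM.hasDerivAt
  simpa [Function.comp_def] using
    ((ContinuousLinearMap.apply ℂ E x).restrictScalars ℝ).hasFDerivAt.comp_hasDerivAt t deriv_exp

/-- The equation `(M u)' = G₁ (M u) + M (G₂ u)` has a dissipative part and a source. -/
theorem IsDissipative.norm_apply_le_add_integral {G₁ G₂ M : Module.End ℂ E}
    (hG₁ : IsDissipative G₁) (hM : Commute M G₁) {u : ℝ → E}
    (hu : ∀ t, HasDerivAt u ((G₁ + G₂) (u t)) t) {c : ℝ} (hc : 0 ≤ c)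
    (hMc : ∀ x, ‖M x‖ ≤ c * ‖x‖) {φ : ℝ → ℝ} (hφ : Continuous φ)
    (hG₂ : ∀ t, 0 ≤ t → ‖G₂ (u t)‖ ≤ φ t) {t : ℝ} (ht : 0 ≤ t) :
    ‖M (u t)‖ ≤ ‖M (u 0)‖ + c * ∫ s in (0 : ℝ)..t, φ s := by
  refine hG₁.norm_le_of_hasDerivAt (x := fun s => M (u s)) (w := fun s => M (G₂ (u s)))
    (B := fun t => ‖M (u 0)‖ + c * ∫ s in (0 : ℝ)..t, φ s) (b := fun s => c * φ s)
    (fun s => ?_) (fun s => ?_) (fun s hs => ?_) (by simp) ht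
  · refine (hasDerivAt_linearMap_comp M (hu s)).congr_deriv ?_
    rw [LinearMap.add_apply, map_add]
    congr 1
    exact LinearMap.congr_fun hM.eq (u s)
  · exact ((hφ.integral_hasStrictDerivAt 0 s).hasDerivAt.const_mul c).const_add _
  · exact (hMc _).trans (mul_le_mul_of_nonneg_left (hG₂ s hs) hc)

theorem le_mul_exp_of_le_integral {φ : ℝ → ℝ} (hφ : Continuous φ) {v β : ℝ} (hv : 0 ≤ v)
    (hβ : 0 ≤ β) (hφ0 : ∀ t, 0 ≤ φ t)
    (h : ∀ t, 0 ≤ t → φ t ≤ v * (1 + ∫ s in (0 : ℝ)..t, (φ s + β))) {t : ℝ} (ht : 0 ≤ t) :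
    φ t ≤ (v + β) * Real.exp (v * t) := by
  let E : ℝ → ℝ := fun t => v * (1 + ∫ s in (0 : ℝ)..t, (φ s + β)) + β
  have hE : ∀ t, HasDerivAt E (v * (φ t + β)) t := fun t =>
    ((((hφ.add continuous_const).integral_hasStrictDerivAt 0 t).hasDerivAt.const_add 1).const_mul
      v).add_const β
  have E_cont : Continuous E := continuous_iff_continuousAt.2 fun t => (hE t).continuousAt
  have φ_le_E : ∀ t, 0 ≤ t → φ t + β ≤ E t := fun t ht => add_le_add_left (h t ht) β
  have E_le := norm_le_gronwallBound_of_norm_deriv_right_le (f := E) (a := 0) (b := t) (K := v)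
    (ε := 0) (δ := v + β) E_cont.continuousOn (fun s _ => (hE s).hasDerivWithinAt)
    (by simp [E, abs_of_nonneg (add_nonneg hv hβ)]) (fun s hs => by
      have := hφ0 s
      rw [Real.norm_of_nonneg (by positivity), add_zero]
      gcongr
      exact (φ_le_E s hs.1).trans (Real.le_norm_self _)) t ⟨ht, le_rfl⟩
  rw [gronwallBound_ε0, sub_zero] at E_le
  linarith [φ_le_E t ht, Real.le_norm_self (E t)]

end Evolution

section Lindblad

variable {ι : Type}

theorem evolution_zero (T : Superop ι) (ρ : Matrix ι ι ℂ) : evolution T 0 ρ = ρ := by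
  rw [evolution, tsum_eq_single 0]
  · simp
  · intro n hn
    simp [hn]

theorem hasDerivAt_evolution [Finite ι] (T : Superop ι) (ρ : Matrix ι ι ℂ) (t : ℝ) :
    HasDerivAt (fun s => evolution T s ρ) (T (evolution T t ρ)) t := by
  classical
  let := Fintype.ofFinite ι
  let : NormedAddCommGroup (Matrix ι ι ℂ) := traceNormedAddCommGroup
  let : NormedSpace ℂ (Matrix ι ι ℂ) := traceNormedSpace
  let : NormedSpace ℝ (Matrix ι ι ℂ) := traceNormedSpace
  exact hasDerivAt_tsum_exp_smul_pow_apply T ρ t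

variable [Fintype ι]

theorem IsLindbladian.exists_eq_effective {T : Superop ι} (hT : IsLindbladian T) :
    ∃ (K : Matrix ι ι ℂ) (k : ℕ) (L : Fin k → Matrix ι ι ℂ), K + Kᴴ + ∑ j, (L j)ᴴ * L j = 0 ∧
      ∀ X, T X = K * X + X * Kᴴ + ∑ j, L j * X * (L j)ᴴ := by
  obtain ⟨H, k, L, hH, hT⟩ := hT
  set S := ∑ j, (L j)ᴴ * L j with hS
  have S_adjoint : Sᴴ = S := by
    simp only [hS, Matrix.conjTranspose_sum, Matrix.conjTranspose_mul,
      Matrix.conjTranspose_conjTranspose]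
  have K_adjoint : (-(Complex.I • H) - (1 / 2 : ℂ) • S)ᴴ = Complex.I • H - (1 / 2 : ℂ) • S := by
    simp [Matrix.conjTranspose_sub, Matrix.conjTranspose_neg, Matrix.conjTranspose_smul, hH.eq,
      S_adjoint]
  refine ⟨-(Complex.I • H) - (1 / 2 : ℂ) • S, k, L, ?_, fun X => ?_⟩
  · rw [K_adjoint]
    module
  · rw [hT, K_adjoint, Finset.sum_sub_distrib, ← Finset.smul_sum, Finset.sum_add_distrib,
      ← Finset.sum_mul, ← Finset.mul_sum, ← hS]
    simp only [Matrix.sub_mul, Matrix.mul_sub, Matrix.neg_mul, Matrix.smul_mul, Matrix.mul_smul]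
    module

variable [DecidableEq ι]

attribute [local instance] traceNormedAddCommGroup traceNormedSpace

theorem IsDissipative.norm_evolution_le {T : Superop ι} (hT : IsDissipative T) (ρ : Matrix ι ι ℂ)
    {t : ℝ} (ht : 0 ≤ t) : ‖evolution T t ρ‖ ≤ ‖ρ‖ := by
  refine hT.norm_le_of_hasDerivAt (x := fun s => evolution T s ρ) (w := 0) (B := fun _ => ‖ρ‖)
    (b := 0) (fun s => ?_) (fun s => hasDerivAt_const _ _) (by simp) (by simp [evolution_zero]) ht
  simpa using hasDerivAt_evolution T ρ s

open scoped Matrix.Norms.L2Operator MatrixOrder in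
theorem exists_posSemidef_smul_one_sub (K : Matrix ι ι ℂ) :
    ∃ M : ℝ, 0 ≤ M ∧ (M • (1 : Matrix ι ι ℂ) - Kᴴ * K).PosSemidef := by
  refine ⟨‖K‖ ^ 2, sq_nonneg _, ?_⟩
  rw [← Algebra.algebraMap_eq_smul_one, ← Matrix.star_eq_conjTranspose, ← Matrix.le_iff]
  exact CStarAlgebra.star_mul_le_algebraMap_norm_sq

theorem IsLindbladian.isDissipative {T : Superop ι} (hT : IsLindbladian T) : IsDissipative T := by
  obtain ⟨K, k, L, sum_eq_zero, hT⟩ := hT.exists_eq_effective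
  obtain ⟨M, M_nonneg, hM⟩ := exists_posSemidef_smul_one_sub K
  refine fun X => ⟨M * ‖X‖ + ‖K * X * Kᴴ‖, fun s hs => ?_⟩
  let E : Option (Fin k) → Matrix ι ι ℂ := fun a => a.elim (1 + s • K) fun j => √s • L j
  have E_map : ∑ a, E a * X * (E a)ᴴ = X + s • T X + s ^ 2 • (K * X * Kᴴ) := by
    rw [Fintype.sum_option, hT]
    simp only [E, Option.elim, Matrix.conjTranspose_add, Matrix.conjTranspose_one,
      Matrix.conjTranspose_smul, star_trivial, Matrix.add_mul, Matrix.mul_add, Matrix.one_mul,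
      Matrix.mul_one, Matrix.smul_mul, Matrix.mul_smul, smul_smul, Real.mul_self_sqrt hs,
      ← Finset.smul_sum]
    module
  have E_norm : ((1 + M * s ^ 2) • (1 : Matrix ι ι ℂ) - ∑ a, (E a)ᴴ * E a).PosSemidef := by
    convert hM.smul (sq_nonneg s) using 1
    rw [Fintype.sum_option]
    simp only [E, Option.elim, Matrix.conjTranspose_add, Matrix.conjTranspose_one,
      Matrix.conjTranspose_smul, star_trivial, Matrix.add_mul, Matrix.mul_add, Matrix.one_mul,
      Matrix.mul_one, Matrix.smul_mul, Matrix.mul_smul, smul_smul, Real.mul_self_sqrt hs,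
      ← Finset.smul_sum]
    rw [eq_neg_of_add_eq_zero_right sum_eq_zero]
    module
  calc ‖X + s • T X‖ = ‖∑ a, E a * X * (E a)ᴴ - s ^ 2 • (K * X * Kᴴ)‖ := by
        rw [E_map, add_sub_cancel_right]
    _ ≤ ‖∑ a, E a * X * (E a)ᴴ‖ + ‖s ^ 2 • (K * X * Kᴴ)‖ := norm_sub_le _ _
    _ ≤ (1 + M * s ^ 2) * ‖X‖ + s ^ 2 * ‖K * X * Kᴴ‖ := by
        rw [norm_smul, Real.norm_of_nonneg (sq_nonneg s)]
        gcongr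
        exact norm_sum_conj_le (by positivity) E_norm X
    _ = ‖X‖ + (M * ‖X‖ + ‖K * X * Kᴴ‖) * s ^ 2 := by ring

end Lindblad

/-! ### Local superoperators -/

section Extend

variable {D : ℕ} {q : Site D → ℕ} {Z Z' Λ : Finset (Site D)}

theorem restrict_replace (h : Z ⊆ Λ) (σ : Cfg q Λ) (a : Cfg q Z) :
    restrict h (replace σ a) = a := by
  funext x
  simp [restrict, replace]

theorem replace_restrict (h : Z ⊆ Λ) (σ : Cfg q Λ) : replace σ (restrict h σ) = σ := by
  funext x
  simp [restrict, replace]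

theorem replace_replace (σ : Cfg q Λ) (a b : Cfg q Z) : replace (replace σ a) b = replace σ b := by
  funext x
  by_cases hx : x.1 ∈ Z <;> simp [replace, hx]

theorem restrict_replace_of_disjoint (h : Z ⊆ Λ) (hd : Disjoint Z Z') (σ : Cfg q Λ)
    (a : Cfg q Z') : restrict h (replace σ a) = restrict h σ := by
  funext x
  simp [restrict, replace, Finset.disjoint_left.1 hd x.2]

theorem replace_comm (hd : Disjoint Z Z') (σ : Cfg q Λ) (a : Cfg q Z) (b : Cfg q Z') :
    replace (replace σ a) b = replace (replace σ b) a := by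
  funext x
  by_cases hx : x.1 ∈ Z
  · simp [replace, hx, Finset.disjoint_left.1 hd hx]
  · simp [replace, hx]

/-- The splitting of the basis labels of `Λ` into labels of `Z ⊆ Λ` and of `Λ ∖ Z`, which
identifies `𝓗_Λ` with `𝓗_Z ⊗ 𝓗_{Λ ∖ Z}`. -/
def splitCfg (q : Site D → ℕ) (h : Z ⊆ Λ) : Cfg q Λ ≃ Cfg q Z × Cfg q (Λ \ Z) where
  toFun σ := (restrict h σ, restrict Finset.sdiff_subset σ)
  invFun p x := if hx : x.1 ∈ Z then p.1 ⟨x.1, hx⟩ else p.2 ⟨x.1, Finset.mem_sdiff.2 ⟨x.2, hx⟩⟩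
  left_inv σ := by
    funext x
    simp [restrict]
  right_inv p := by
    ext x
    · simp [restrict]
    · simp [restrict, (Finset.mem_sdiff.1 x.2).2]

theorem splitCfg_symm_eq_replace (h : Z ⊆ Λ) (σ : Cfg q Λ) (a : Cfg q Z) :
    (splitCfg q h).symm (a, restrict Finset.sdiff_subset σ) = replace σ a := rfl

/-- The operator on `𝓗_Z` with the matrix elements of `X` between labels that agree with `σ`,
respectively `σ'`, outside `Z`; a superoperator supported in `Z` acts on each block separately. -/
def block (σ σ' : Cfg q Λ) : Op q Λ →ₗ[ℂ] Op q Z where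
  toFun X := Matrix.of fun a b => X (replace σ a) (replace σ' b)
  map_add' _ _ := rfl
  map_smul' _ _ := rfl

theorem block_apply (σ σ' : Cfg q Λ) (X : Op q Λ) (a b : Cfg q Z) :
    block σ σ' X a b = X (replace σ a) (replace σ' b) := rfl

theorem extend_apply (h : Z ⊆ Λ) (T : Superop (Cfg q Z)) (X : Op q Λ) (σ σ' : Cfg q Λ) :
    extend h T X σ σ' = T (block σ σ' X) (restrict h σ) (restrict h σ') := rfl

theorem apply_eq_block (h : Z ⊆ Λ) (X : Op q Λ) (σ σ' : Cfg q Λ) :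
    X σ σ' = (block σ σ' X : Op q Z) (restrict h σ) (restrict h σ') := by
  rw [block_apply, replace_restrict, replace_restrict]

/-- The operator `A ⊗ 1` on `𝓗_Λ`, for `A` on `𝓗_Z`. -/
def lift (h : Z ⊆ Λ) (A : Op q Z) : Op q Λ := Matrix.of fun σ σ' =>
  if restrict (Finset.sdiff_subset (t := Z)) σ = restrict Finset.sdiff_subset σ' then
    A (restrict h σ) (restrict h σ') else 0

theorem lift_conjTranspose (h : Z ⊆ Λ) (A : Op q Z) : (lift h A)ᴴ = lift h Aᴴ := by
  ext σ σ'
  simp only [lift, Matrix.conjTranspose_apply, Matrix.of_apply, apply_ite star, star_zero, eq_comm]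

theorem sum_ite_restrict_eq (h : Z ⊆ Λ) (σ : Cfg q Λ) (f : Cfg q Λ → ℂ) :
    (∑ τ, if restrict (Finset.sdiff_subset (t := Z)) σ = restrict Finset.sdiff_subset τ then f τ
      else 0) = ∑ a : Cfg q Z, f (replace σ a) := by
  rw [← (splitCfg q h).symm.sum_comp, Fintype.sum_prod_type]
  refine Finset.sum_congr rfl fun a _ => ?_
  have restrict_symm : ∀ b,
      restrict (Finset.sdiff_subset (t := Z)) ((splitCfg q h).symm (a, b)) = b := fun b =>
    congrArg Prod.snd ((splitCfg q h).apply_symm_apply (a, b))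
  simp only [restrict_symm, Finset.sum_ite_eq, Finset.mem_univ, if_true, splitCfg_symm_eq_replace]

theorem block_lift_mul (h : Z ⊆ Λ) (A : Op q Z) (X : Op q Λ) (σ σ' : Cfg q Λ) :
    (block σ σ' (lift h A * X) : Op q Z) = A * block σ σ' X := by
  ext a b
  simp only [block_apply, Matrix.mul_apply, lift, Matrix.of_apply, ite_mul, zero_mul,
    sum_ite_restrict_eq h, restrict_replace, replace_replace]

theorem block_mul_lift (h : Z ⊆ Λ) (A : Op q Z) (X : Op q Λ) (σ σ' : Cfg q Λ) :
    (block σ σ' (X * lift h A) : Op q Z) = block σ σ' X * A := by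
  ext a b
  simp only [block_apply, Matrix.mul_apply, lift, Matrix.of_apply, mul_ite, mul_zero,
    eq_comm (b := restrict _ (replace σ' b)), sum_ite_restrict_eq h, restrict_replace,
    replace_replace]

theorem IsLindbladian.extend (h : Z ⊆ Λ) {T : Superop (Cfg q Z)} (hT : IsLindbladian T) :
    IsLindbladian (extend h T) := by
  obtain ⟨H, k, L, hH, hL⟩ := hT
  refine ⟨lift h H, k, fun j => lift h (L j), ?_, fun X => ?_⟩
  · rw [Matrix.IsHermitian, lift_conjTranspose, hH.eq]
  · ext σ σ'
    rw [extend_apply, hL, apply_eq_block h (_ + _)]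
    simp only [map_add, map_sub, map_sum, map_smul, lift_conjTranspose, block_lift_mul,
      block_mul_lift, Matrix.mul_assoc]
    simp only [← Matrix.mul_assoc, block_mul_lift]

theorem superop_apply_eq_sum {ι : Type} [Fintype ι] [DecidableEq ι] (T : Superop ι)
    (X : Matrix ι ι ℂ) (i j : ι) :
    T X i j = ∑ p : ι × ι, X p.1 p.2 * T (Matrix.single p.1 p.2 1) i j := by
  conv_lhs => rw [Matrix.matrix_eq_sum_single X, ← Fintype.sum_prod_type', map_sum,
    Matrix.sum_apply]
  refine Finset.sum_congr rfl fun p _ => ?_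
  rw [← mul_one (X p.1 p.2), ← smul_eq_mul, ← Matrix.smul_single, map_smul, Matrix.smul_apply,
    smul_eq_mul, smul_eq_mul, mul_one]

theorem extend_apply_eq_sum (h : Z ⊆ Λ) (T : Superop (Cfg q Z)) (X : Op q Λ) (σ σ' : Cfg q Λ) :
    extend h T X σ σ' = ∑ p : Cfg q Z × Cfg q Z, X (replace σ p.1) (replace σ' p.2) *
      T (Matrix.single p.1 p.2 1) (restrict h σ) (restrict h σ') :=
  superop_apply_eq_sum T (block σ σ' X) _ _

theorem commute_extend (h : Z ⊆ Λ) (h' : Z' ⊆ Λ) (hd : Disjoint Z Z') (T : Superop (Cfg q Z))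
    (T' : Superop (Cfg q Z')) : Commute (extend h T) (extend h' T') := by
  refine LinearMap.ext fun X => ?_
  ext σ σ'
  simp only [Module.End.mul_apply, extend_apply_eq_sum, Finset.sum_mul,
    restrict_replace_of_disjoint h hd, restrict_replace_of_disjoint h' hd.symm]
  rw [Finset.sum_comm]
  refine Finset.sum_congr rfl fun p' _ => Finset.sum_congr rfl fun p _ => ?_
  rw [replace_comm hd, replace_comm hd, mul_right_comm]

theorem extend_tensor {Λ' : Finset (Site D)} (hZ : Z ⊆ Λ') (h : Λ' ⊆ Λ) (T : Superop (Cfg q Z))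
    (ρ : Op q Λ') (τ : Op q (Λ \ Λ')) :
    extend (hZ.trans h) T (tensor h ρ τ) = tensor h (extend hZ T ρ) τ := by
  ext σ σ'
  have disjoint : Disjoint (Λ \ Λ') Z := Finset.disjoint_of_subset_right hZ Finset.sdiff_disjoint
  have block_tensor : (block σ σ' (tensor h ρ τ) : Op q Z) =
      τ (restrict Finset.sdiff_subset σ) (restrict Finset.sdiff_subset σ') •
        block (restrict h σ) (restrict h σ') ρ := by
    ext a b
    rw [block_apply, tensor, Matrix.of_apply, restrict_replace_of_disjoint _ disjoint,
      restrict_replace_of_disjoint _ disjoint, mul_comm]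
    rfl
  rw [extend_apply, block_tensor, map_smul, Matrix.smul_apply, smul_eq_mul, mul_comm]
  rfl

theorem tensor_zero {Λ' : Finset (Site D)} (h : Λ' ⊆ Λ) (τ : Op q (Λ \ Λ')) :
    tensor h (0 : Op q Λ') τ = 0 := by
  ext σ σ'
  simp [tensor]

theorem IsState.tensor {Λ' : Finset (Site D)} {h : Λ' ⊆ Λ} {ρ : Op q Λ'} {τ : Op q (Λ \ Λ')}
    (hρ : IsState ρ) (hτ : IsState τ) : IsState (tensor h ρ τ) := by
  refine ⟨(hρ.1.kronecker hτ.1).submatrix (splitCfg q h), ?_⟩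
  calc (OpenLattice.tensor h ρ τ).trace = (Matrix.kronecker ρ τ).trace :=
        (splitCfg q h).sum_comp fun i => Matrix.kronecker ρ τ i i
    _ = ρ.trace * τ.trace := Matrix.trace_kronecker ρ τ
    _ = 1 := by rw [hρ.2, hτ.2, one_mul]

theorem traceNorm_ampliate_le {ι : Type} [Fintype ι] [DecidableEq ι] {T : Superop ι}
    (hT : diamondNorm T ≠ ⊤) {n : ℕ} (X : Matrix (ι × Fin n) (ι × Fin n) ℂ) :
    traceNorm (ampliate T n X) ≤ (diamondNorm T).toReal * traceNorm X := by
  rcases eq_or_ne X 0 with rfl | hX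
  · have ampliate_zero : ampliate T n 0 = 0 := by
      ext p r
      exact congrFun (congrFun (map_zero T) p.1) r.1
    rw [ampliate_zero, traceNorm_zero, mul_zero]
  have ratio_le : ENNReal.ofReal (traceNorm (ampliate T n X)) / ENNReal.ofReal (traceNorm X) ≤
      diamondNorm T := le_iSup₂_of_le n X (le_iSup_of_le hX le_rfl)
  rw [ENNReal.div_le_iff_le_mul (Or.inr hT) (Or.inl ENNReal.ofReal_ne_top),
    ← ENNReal.ofReal_toReal hT, ← ENNReal.ofReal_mul ENNReal.toReal_nonneg] at ratio_le
  exact (ENNReal.ofReal_le_ofReal_iff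
    (mul_nonneg ENNReal.toReal_nonneg (traceNorm_nonneg _))).1 ratio_le

theorem traceNorm_extend_le (h : Z ⊆ Λ) {T : Superop (Cfg q Z)} (hT : diamondNorm T ≠ ⊤)
    (X : Op q Λ) : traceNorm (extend h T X) ≤ (diamondNorm T).toReal * traceNorm X := by
  let e : Cfg q Λ ≃ Cfg q Z × Fin (Fintype.card (Cfg q (Λ \ Z))) :=
    (splitCfg q h).trans (Equiv.prodCongr (Equiv.refl _) (Fintype.equivFin _))
  have e_symm : ∀ (σ : Cfg q Λ) (a : Cfg q Z), e.symm (a, (e σ).2) = replace σ a := fun σ a => by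
    simp [e, ← splitCfg_symm_eq_replace h, splitCfg]
  have extend_eq : extend h T X = (ampliate T _ (X.submatrix e.symm e.symm)).submatrix e e := by
    ext σ σ'
    simp only [Matrix.submatrix_apply, ampliate, Matrix.of_apply, e_symm]
    rfl
  rw [extend_eq, traceNorm_submatrix_equiv, ← traceNorm_submatrix_equiv e.symm X]
  exact traceNorm_ampliate_le hT _

end Extend

/-! ### The terms of a uniform family -/

section Distance

variable {D : ℕ}

theorem siteDist_self (x : Site D) : siteDist x x = 0 := by simp [siteDist]

theorem siteDist_triangle (x y z : Site D) : siteDist x z ≤ siteDist x y + siteDist y z := by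
  unfold siteDist
  rw [← Finset.sum_add_distrib]
  exact Finset.sum_le_sum fun i _ => by omega

theorem siteDist_le_diam {Z : Finset (Site D)} {x y : Site D} (hx : x ∈ Z) (hy : y ∈ Z) :
    siteDist x y ≤ diam Z :=
  Finset.le_sup (f := fun p : Site D × Site D => siteDist p.1 p.2) (Finset.mk_mem_product hx hy)

end Distance

namespace UniformFamily

section Terms

variable {D : ℕ} {q : Site D → ℕ} (F : UniformFamily D q) {Λ Y Z : Finset (Site D)}
  {𝓒 : Finset (Site D × ℕ)}

/-- The term `𝓜_Z`, acting on `𝓐_Λ`; it is set to `0` unless `Z ⊆ Λ`, so that sums over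
`Z` can run over sets rather than over subtypes. -/
noncomputable def bulkTerm (Λ Z : Finset (Site D)) : Superop (Cfg q Λ) :=
  if h : Z ⊆ Λ then extend h (F.bulk Z) else 0

theorem bulkTerm_of_subset (h : Z ⊆ Λ) : F.bulkTerm Λ Z = extend h (F.bulk Z) := dif_pos h

/-- The pairs `(c, d)` for which `𝓑_d^{∂c}` is one of the boundary terms of `region 𝓒`. -/
def bdIndex (𝓒 : Finset (Site D × ℕ)) : Finset (Σ _ : 𝓒, ℕ) :=
  Finset.univ.sigma fun c => Finset.Icc 1 (c.1.2 + 1)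

/-- The support of the boundary term `𝓑_d^{∂c}`. -/
noncomputable def bdSupport (c : Site D × ℕ) (d : ℕ) : Finset (Site D) := bdry d (ball c.1 c.2)

/-- The diamond norm of `𝓜_Z` as a real number, with the junk value `0` if it is infinite. -/
noncomputable def bulkNorm (Z : Finset (Site D)) : ℝ := (diamondNorm (F.bulk Z)).toReal

/-- The diamond norm of `𝓑_d^{∂c}` as a real number, with the junk value `0` if it is infinite. -/
noncomputable def bdNorm (c : Site D × ℕ) (d : ℕ) : ℝ := (diamondNorm (F.bd c.1 c.2 d)).toReal

theorem bulkNorm_nonneg (Z : Finset (Site D)) : 0 ≤ F.bulkNorm Z := ENNReal.toReal_nonneg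

theorem bdNorm_nonneg (c : Site D × ℕ) (d : ℕ) : 0 ≤ F.bdNorm c d := ENNReal.toReal_nonneg

theorem bulkGen_eq_sum (h : Y ⊆ Λ) : F.bulkGen h = ∑ Z ∈ Y.powerset, F.bulkTerm Λ Z := by
  rw [bulkGen, ← Finset.sum_coe_sort Y.powerset (F.bulkTerm Λ)]
  exact Finset.sum_congr rfl fun Z _ => (F.bulkTerm_of_subset _).symm

theorem closedGen_eq_sum (𝓒 : Finset (Site D × ℕ)) :
    F.closedGen 𝓒 = ∑ Z ∈ (region 𝓒).powerset, F.bulkTerm (region 𝓒) Z +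
      ∑ p ∈ bdIndex 𝓒, F.bdTerm p.1 p.2 := by
  rw [closedGen, bulkGen_eq_sum, bdIndex, Finset.sum_sigma]

theorem cutGen_eq_sum (𝓒 : Finset (Site D × ℕ)) (A : Finset (Site D)) (k : ℕ) :
    F.cutGen 𝓒 A k = ∑ Z ∈ (region 𝓒).powerset with Disjoint Z A, F.bulkTerm (region 𝓒) Z +
      ∑ p ∈ bdIndex 𝓒 with p.2 ≤ k, F.bdTerm p.1 p.2 := by
  have powerset_sdiff :
      (region 𝓒 \ A).powerset = {Z ∈ (region 𝓒).powerset | Disjoint Z A} := by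
    ext Z
    simp only [Finset.mem_powerset, Finset.mem_filter, Finset.subset_sdiff]
  rw [cutGen, bulkGen_eq_sum, powerset_sdiff, bdIndex]
  simp only [Finset.sum_filter, Finset.sum_sigma]

attribute [local instance] traceNormedAddCommGroup traceNormedSpace

theorem isDissipative_bulkTerm (Λ Z : Finset (Site D)) : IsDissipative (F.bulkTerm Λ Z) := by
  unfold bulkTerm
  split_ifs with h
  exacts [((F.bulk_lindbladian Z).extend h).isDissipative, isDissipative_zero]

theorem isDissipative_bdTerm (c : 𝓒) (d : ℕ) : IsDissipative (F.bdTerm c d) :=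
  ((F.bd_lindbladian _ _ _).extend _).isDissipative

theorem isDissipative_sum_bulkTerm_add_sum_bdTerm (S : Finset (Finset (Site D)))
    (P : Finset (Σ _ : 𝓒, ℕ)) :
    IsDissipative (∑ Z ∈ S, F.bulkTerm (region 𝓒) Z + ∑ p ∈ P, F.bdTerm p.1 p.2) :=
  (isDissipative_sum fun _ _ => F.isDissipative_bulkTerm _ _).add
    (isDissipative_sum fun _ _ => F.isDissipative_bdTerm _ _)

theorem isDissipative_closedGen (𝓒 : Finset (Site D × ℕ)) : IsDissipative (F.closedGen 𝓒) :=
  F.closedGen_eq_sum 𝓒 ▸ F.isDissipative_sum_bulkTerm_add_sum_bdTerm _ _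

theorem isDissipative_cutGen (𝓒 : Finset (Site D × ℕ)) (A : Finset (Site D)) (k : ℕ) :
    IsDissipative (F.cutGen 𝓒 A k) :=
  F.cutGen_eq_sum 𝓒 A k ▸ F.isDissipative_sum_bulkTerm_add_sum_bdTerm _ _

/-- The quantity `∑_{Z ∋ x, Z ⊆ Λ} ‖𝓜_Z(X)‖₁`, which measures how far the operator `X` is, at the
site `x`, from being annihilated by the bulk terms. -/
noncomputable def siteNorm (X : Op q Λ) (x : Site D) : ℝ :=
  ∑ Z ∈ Λ.powerset with x ∈ Z, ‖F.bulkTerm Λ Z X‖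

theorem siteNorm_nonneg (X : Op q Λ) (x : Site D) : 0 ≤ F.siteNorm X x :=
  Finset.sum_nonneg fun _ _ => norm_nonneg _

theorem continuous_siteNorm (x : Site D) : Continuous fun X : Op q Λ => F.siteNorm X x :=
  continuous_finsetSum _ fun Z _ =>
    (LinearMap.continuous_of_finiteDimensional (F.bulkTerm Λ Z)).norm

theorem sum_norm_bulkTerm_le (X : Op q Λ) {S : Finset (Finset (Site D))}
    (hS : ∀ Z ∈ S, Z ⊆ Λ ∧ ¬ Disjoint Z Y) :
    ∑ Z ∈ S, ‖F.bulkTerm Λ Z X‖ ≤ ∑ y ∈ Y, F.siteNorm X y := by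
  simp only [siteNorm, Finset.sum_filter]
  rw [Finset.sum_comm]
  have term_nonneg : ∀ Z, ∀ y ∈ Y, 0 ≤ if y ∈ Z then ‖F.bulkTerm Λ Z X‖ else 0 := fun Z y _ =>
    ite_nonneg (norm_nonneg _) le_rfl
  calc ∑ Z ∈ S, ‖F.bulkTerm Λ Z X‖
      ≤ ∑ Z ∈ S, ∑ y ∈ Y, if y ∈ Z then ‖F.bulkTerm Λ Z X‖ else 0 :=
        Finset.sum_le_sum fun Z hZ => by
          obtain ⟨y, hyZ, hyY⟩ := Finset.not_disjoint_iff.1 (hS Z hZ).2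
          simpa only [if_pos hyZ] using Finset.single_le_sum (term_nonneg Z) hyY
    _ ≤ ∑ Z ∈ Λ.powerset, ∑ y ∈ Y, if y ∈ Z then ‖F.bulkTerm Λ Z X‖ else 0 :=
        Finset.sum_le_sum_of_subset_of_nonneg
          (fun Z hZ => Finset.mem_powerset.2 (hS Z hZ).1)
          fun Z _ _ => Finset.sum_nonneg (term_nonneg Z)

end Terms

section Decay

variable {D : ℕ} {q : Site D → ℕ} {F : UniformFamily D q} {ν : ℕ → ℝ} {v : ℝ}
  {Λ Y Z : Finset (Site D)} {𝓒 : Finset (Site D × ℕ)}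

theorem LiebRobinson.diamondNorm_bulk_ne_top (h : F.LiebRobinson ν v) (hZ : Z.Nonempty) :
    diamondNorm (F.bulk Z) ≠ ⊤ := by
  obtain ⟨x, hx⟩ := hZ
  intro eq_top
  have term_le := (ENNReal.le_tsum (f := fun Z : {Z : Finset (Site D) // x ∈ Z} =>
    diamondNorm (F.bulk Z) * (Z.1.card : ℝ≥0∞) * ENNReal.ofReal (ν (diam Z.1))) ⟨Z, hx⟩).trans
      (h.bulk_decay x)
  have card_ne_zero : (Z.card : ℝ≥0∞) ≠ 0 := by simpa using Finset.ne_empty_of_mem hx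
  have weight_ne_zero : ENNReal.ofReal (ν (diam Z)) ≠ 0 := by simpa using h.pos _
  simp only [eq_top, ENNReal.top_mul card_ne_zero, ENNReal.top_mul weight_ne_zero,
    top_le_iff] at term_le
  exact ENNReal.ofReal_ne_top term_le

theorem LiebRobinson.sum_bulkNorm_le (h : F.LiebRobinson ν v) {x : Site D}
    {S : Finset (Finset (Site D))} (hS : ∀ Z ∈ S, x ∈ Z) :
    ∑ Z ∈ S, F.bulkNorm Z * (Z.card * ν (diam Z)) ≤ v := by
  have sum_le := (ENNReal.sum_le_tsum (f := fun Z : {Z : Finset (Site D) // x ∈ Z} =>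
    diamondNorm (F.bulk Z) * (Z.1.card : ℝ≥0∞) * ENNReal.ofReal (ν (diam Z.1)))
      (S.subtype (x ∈ ·))).trans (h.bulk_decay x)
  rw [Finset.sum_subtype_of_mem (fun Z : Finset (Site D) =>
    diamondNorm (F.bulk Z) * (Z.card : ℝ≥0∞) * ENNReal.ofReal (ν (diam Z))) hS] at sum_le
  have term_eq : ∀ Z ∈ S, ENNReal.ofReal (F.bulkNorm Z * (Z.card * ν (diam Z))) =
      diamondNorm (F.bulk Z) * (Z.card : ℝ≥0∞) * ENNReal.ofReal (ν (diam Z)) := fun Z hZ => by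
    rw [bulkNorm, ENNReal.ofReal_mul ENNReal.toReal_nonneg, ENNReal.ofReal_mul (Nat.cast_nonneg _),
      ENNReal.ofReal_toReal (h.diamondNorm_bulk_ne_top ⟨x, hS Z hZ⟩), ENNReal.ofReal_natCast,
      mul_assoc]
  rw [← Finset.sum_congr rfl term_eq, ← ENNReal.ofReal_sum_of_nonneg fun Z _ =>
    mul_nonneg (F.bulkNorm_nonneg Z) (mul_nonneg (Nat.cast_nonneg _) (h.pos _).le)] at sum_le
  exact (ENNReal.ofReal_le_ofReal_iff h.nonneg).1 sum_le

theorem LiebRobinson.diamondNorm_bd_ne_top (h : F.LiebRobinson ν v) {u : Site D} {N d : ℕ}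
    (hd : d ∈ Finset.Icc 1 (N + 1)) : diamondNorm (F.bd u N d) ≠ ⊤ := by
  obtain ⟨P, hP⟩ := h.bd_decay
  intro eq_top
  have sum_eq_top : ∑ d ∈ Finset.Icc 1 (N + 1), diamondNorm (F.bd u N d) = ⊤ :=
    ENNReal.sum_eq_top.2 ⟨d, hd, eq_top⟩
  have sum_le := hP u N 1 le_rfl
  have weight_ne_zero : ENNReal.ofReal (ν 1) ≠ 0 := by simpa using h.pos _
  rw [sum_eq_top, ENNReal.mul_top weight_ne_zero, top_le_iff] at sum_le
  exact ENNReal.ofReal_ne_top sum_le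

theorem LiebRobinson.exists_mul_sum_bdNorm_le (h : F.LiebRobinson ν v) :
    ∃ P : Polynomial ℝ, ∀ (c : Site D × ℕ) (r : ℕ), 1 ≤ r →
      ν r * ∑ d ∈ Finset.Icc r (c.2 + 1), F.bdNorm c d ≤ |P.eval (c.2 : ℝ)| := by
  obtain ⟨P, hP⟩ := h.bd_decay
  refine ⟨P, fun c r hr => ?_⟩
  have finite : ∀ d ∈ Finset.Icc r (c.2 + 1), ENNReal.ofReal (F.bdNorm c d) =
      diamondNorm (F.bd c.1 c.2 d) := fun d hd => ENNReal.ofReal_toReal <|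
    h.diamondNorm_bd_ne_top (Finset.Icc_subset_Icc_left hr hd)
  have sum_le := (hP c.1 c.2 r hr).trans (ENNReal.ofReal_le_ofReal (le_abs_self _))
  rw [← Finset.sum_congr rfl finite, ← ENNReal.ofReal_sum_of_nonneg fun d _ => F.bdNorm_nonneg c d,
    ← ENNReal.ofReal_mul (h.pos _).le] at sum_le
  exact (ENNReal.ofReal_le_ofReal_iff (abs_nonneg _)).1 sum_le

attribute [local instance] traceNormedAddCommGroup traceNormedSpace

theorem LiebRobinson.norm_bulkTerm_apply_le (h : F.LiebRobinson ν v) (hZ : Z.Nonempty)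
    (X : Op q Λ) : ‖F.bulkTerm Λ Z X‖ ≤ F.bulkNorm Z * ‖X‖ := by
  unfold bulkTerm
  split_ifs with hZΛ
  · exact traceNorm_extend_le hZΛ (h.diamondNorm_bulk_ne_top hZ) X
  · rw [LinearMap.zero_apply, norm_zero]
    exact mul_nonneg (F.bulkNorm_nonneg Z) (norm_nonneg X)

theorem LiebRobinson.norm_bdTerm_apply_le (h : F.LiebRobinson ν v) {p : Σ _ : 𝓒, ℕ}
    (hp : p ∈ bdIndex 𝓒) (X : Op q (region 𝓒)) :
    ‖F.bdTerm p.1 p.2 X‖ ≤ F.bdNorm p.1 p.2 * ‖X‖ :=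
  traceNorm_extend_le _ (h.diamondNorm_bd_ne_top (Finset.mem_sigma.1 hp).2) X

theorem LiebRobinson.norm_sum_bulkTerm_add_sum_bdTerm_le (h : F.LiebRobinson ν v)
    {S : Finset (Finset (Site D))} (hS : ∀ Z ∈ S, Z ⊆ region 𝓒 ∧ ¬ Disjoint Z Y)
    {P : Finset (Σ _ : 𝓒, ℕ)} (hP : P ⊆ bdIndex 𝓒) {X : Op q (region 𝓒)} (hX : ‖X‖ ≤ 1) :
    ‖(∑ Z ∈ S, F.bulkTerm (region 𝓒) Z + ∑ p ∈ P, F.bdTerm p.1 p.2) X‖ ≤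
      ∑ y ∈ Y, F.siteNorm X y + ∑ p ∈ P, F.bdNorm p.1 p.2 := by
  rw [LinearMap.add_apply, LinearMap.sum_apply, LinearMap.sum_apply]
  refine norm_add_le_of_le ((norm_sum_le _ _).trans (F.sum_norm_bulkTerm_le X hS))
    (norm_sum_le_of_le _ fun p hp => ?_)
  exact (h.norm_bdTerm_apply_le (hP hp) X).trans
    (mul_le_of_le_one_right (F.bdNorm_nonneg _ _) hX)

end Decay

end UniformFamily

/-! ### The Lieb-Robinson estimate -/

-- The summand `1` covers the case `v = 0`, where `v⁻¹ = 0`.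
theorem exp_le_mul_exp_mul_add_one {v : ℝ} (hv : 0 ≤ v) (s : ℝ) :
    Real.exp (v * s) ≤ (1 + v⁻¹) * (Real.exp (v * s) * v + 1) := by
  rcases hv.eq_or_lt with rfl | hv
  · simp
  · have inv_pos : 0 < v⁻¹ := inv_pos.2 hv
    have exp_mul_nonneg : 0 ≤ Real.exp (v * s) * v := by positivity
    have exp_eq : v⁻¹ * (Real.exp (v * s) * v) = Real.exp (v * s) := by field_simp
    linarith

/-- Weights on the sites which vary with the distance no faster than `ν` grows, and which are at
most `ν d` on the supports of the boundary terms `𝓑_d` of `region 𝓒`. -/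
structure IsAdmissibleWeight {D : ℕ} (ν : ℕ → ℝ) (𝓒 : Finset (Site D × ℕ)) (w : Site D → ℝ) :
    Prop where
  pos : ∀ x, 0 < w x
  le_mul : ∀ x y, w x ≤ w y * ν (siteDist x y)
  le_of_mem_bdSupport : ∀ c ∈ 𝓒, ∀ d, ∀ y ∈ UniformFamily.bdSupport c d, w y ≤ ν d

namespace UniformFamily

section Splitting

variable {D : ℕ} {q : Site D → ℕ} (F : UniformFamily D q) (𝓒 : Finset (Site D × ℕ))
  (A Y : Finset (Site D))

/-- The terms of `F.closedGen 𝓒` that are supported away from `Y`. -/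
noncomputable def farGen : Superop (Cfg q (region 𝓒)) :=
  ∑ Z ∈ (region 𝓒).powerset with Disjoint Z Y, F.bulkTerm (region 𝓒) Z +
    ∑ p ∈ bdIndex 𝓒 with Disjoint (bdSupport p.1 p.2) Y, F.bdTerm p.1 p.2

/-- The terms of `F.closedGen 𝓒` whose support meets `Y`. -/
noncomputable def nearGen : Superop (Cfg q (region 𝓒)) :=
  ∑ Z ∈ (region 𝓒).powerset with ¬ Disjoint Z Y, F.bulkTerm (region 𝓒) Z +
    ∑ p ∈ bdIndex 𝓒 with ¬ Disjoint (bdSupport p.1 p.2) Y, F.bdTerm p.1 p.2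

theorem farGen_add_nearGen : F.farGen 𝓒 Y + F.nearGen 𝓒 Y = F.closedGen 𝓒 := by
  rw [farGen, nearGen, add_add_add_comm, Finset.sum_filter_add_sum_filter_not,
    Finset.sum_filter_add_sum_filter_not, closedGen_eq_sum]

theorem closedGen_sub_cutGen (k : ℕ) : F.closedGen 𝓒 - F.cutGen 𝓒 A k =
    ∑ Z ∈ (region 𝓒).powerset with ¬ Disjoint Z A, F.bulkTerm (region 𝓒) Z +
      ∑ p ∈ bdIndex 𝓒 with ¬ p.2 ≤ k, F.bdTerm p.1 p.2 := by
  rw [closedGen_eq_sum, cutGen_eq_sum, sub_eq_iff_eq_add', add_add_add_comm,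
    Finset.sum_filter_add_sum_filter_not, Finset.sum_filter_add_sum_filter_not]

theorem commute_bulkTerm_farGen : Commute (F.bulkTerm (region 𝓒) Y) (F.farGen 𝓒 Y) := by
  by_cases hY : Y ⊆ region 𝓒
  · rw [F.bulkTerm_of_subset hY]
    refine (Commute.sum_right _ _ _ fun Z hZ => ?_).add_right
      (Commute.sum_right _ _ _ fun p hp => ?_)
    · rw [Finset.mem_filter, Finset.mem_powerset] at hZ
      rw [F.bulkTerm_of_subset hZ.1]
      exact commute_extend _ _ hZ.2.symm _ _
    · exact commute_extend _ _ (Finset.mem_filter.1 hp).2.symm _ _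
  · rw [bulkTerm, dif_neg hY]
    exact Commute.zero_left _

attribute [local instance] traceNormedAddCommGroup traceNormedSpace

theorem isDissipative_farGen : IsDissipative (F.farGen 𝓒 Y) :=
  F.isDissipative_sum_bulkTerm_add_sum_bdTerm _ _

/-- The total weight `∑ ν(d) ‖𝓑_d^{∂c}‖_⋄` of the boundary terms of `region 𝓒`. -/
noncomputable def bdWeight (ν : ℕ → ℝ) : ℝ := ∑ p ∈ bdIndex 𝓒, ν p.2 * F.bdNorm p.1 p.2

/-- The largest of the numbers `w(x) ∑_{Z ∋ x, Z ⊆ Λ} ‖𝓜_Z(X)‖₁`, for `x ∈ Λ`. -/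
noncomputable def weightedNorm {Λ : Finset (Site D)} (w : Site D → ℝ) (X : Op q Λ) : ℝ :=
  ‖fun x : Λ => w x * F.siteNorm X x‖

theorem mul_siteNorm_le_weightedNorm {Λ : Finset (Site D)} (w : Site D → ℝ) (X : Op q Λ)
    {x : Site D} (hx : x ∈ Λ) : w x * F.siteNorm X x ≤ F.weightedNorm w X :=
  (le_abs_self _).trans (norm_le_pi_norm (fun x : Λ => w x * F.siteNorm X x) ⟨x, hx⟩)

theorem continuous_weightedNorm {Λ : Finset (Site D)} (w : Site D → ℝ) :
    Continuous fun X : Op q Λ => F.weightedNorm w X :=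
  (continuous_pi fun x : Λ => continuous_const.mul (F.continuous_siteNorm x.1)).norm

end Splitting

section LightCone

variable {D : ℕ} {q : Site D → ℕ} {F : UniformFamily D q} {ν : ℕ → ℝ} {v : ℝ}
  {𝓒 : Finset (Site D × ℕ)} {w : Site D → ℝ} {A Y : Finset (Site D)} {x y : Site D}
  {X X₀ : Op q (region 𝓒)} {t : ℝ}

theorem LiebRobinson.bdWeight_nonneg (h : F.LiebRobinson ν v) : 0 ≤ F.bdWeight 𝓒 ν :=
  Finset.sum_nonneg fun _ _ => mul_nonneg (h.pos _).le (F.bdNorm_nonneg _ _)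

theorem LiebRobinson.weight_le_mul (h : F.LiebRobinson ν v) (hw : IsAdmissibleWeight ν 𝓒 w)
    (hx : x ∈ Y) (hy : y ∈ Y) : w x ≤ ν (diam Y) * w y := by
  rw [mul_comm]
  exact (hw.le_mul x y).trans <|
    mul_le_mul_of_nonneg_left (h.mono (siteDist_le_diam hx hy)) (hw.pos y).le

theorem LiebRobinson.mul_sum_siteNorm_le (h : F.LiebRobinson ν v)
    (hw : IsAdmissibleWeight ν 𝓒 w) (hY : Y ⊆ region 𝓒) (hx : x ∈ Y) (X : Op q (region 𝓒)) :
    w x * ∑ y ∈ Y, F.siteNorm X y ≤ Y.card * ν (diam Y) * F.weightedNorm w X := by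
  rw [Finset.mul_sum, mul_assoc, ← nsmul_eq_mul]
  refine Finset.sum_le_card_nsmul _ _ _ fun y hy => ?_
  calc w x * F.siteNorm X y
      ≤ ν (diam Y) * w y * F.siteNorm X y :=
        mul_le_mul_of_nonneg_right (h.weight_le_mul hw hx hy) (F.siteNorm_nonneg X y)
    _ = ν (diam Y) * (w y * F.siteNorm X y) := mul_assoc _ _ _
    _ ≤ ν (diam Y) * F.weightedNorm w X :=
        mul_le_mul_of_nonneg_left (F.mul_siteNorm_le_weightedNorm w X (hY hy)) (h.pos _).le

theorem LiebRobinson.mul_sum_bdNorm_le (h : F.LiebRobinson ν v)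
    (hw : IsAdmissibleWeight ν 𝓒 w) (hx : x ∈ Y) :
    w x * ∑ p ∈ bdIndex 𝓒 with ¬ Disjoint (bdSupport p.1 p.2) Y, F.bdNorm p.1 p.2 ≤
      ν (diam Y) * F.bdWeight 𝓒 ν := by
  rw [bdWeight, Finset.mul_sum, Finset.mul_sum, Finset.sum_filter]
  refine Finset.sum_le_sum fun p _ => ?_
  by_cases hp : Disjoint (bdSupport p.1 p.2) Y
  · rw [if_neg (not_not.2 hp)]
    exact mul_nonneg (h.pos _).le (mul_nonneg (h.pos _).le (F.bdNorm_nonneg _ _))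
  · obtain ⟨y, hyp, hyY⟩ := Finset.not_disjoint_iff.1 hp
    have weight_le : w x ≤ ν (diam Y) * ν p.2 := (h.weight_le_mul hw hx hyY).trans <|
      mul_le_mul_of_nonneg_left (hw.le_of_mem_bdSupport _ p.1.2 _ _ hyp) (h.pos _).le
    rw [if_pos hp, ← mul_assoc]
    exact mul_le_mul_of_nonneg_right weight_le (F.bdNorm_nonneg _ _)

attribute [local instance] traceNormedAddCommGroup traceNormedSpace

theorem LiebRobinson.mul_norm_nearGen_apply_le (h : F.LiebRobinson ν v)
    (hw : IsAdmissibleWeight ν 𝓒 w) (hY : Y ⊆ region 𝓒) (hx : x ∈ Y) (hX : ‖X‖ ≤ 1) :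
    w x * ‖F.nearGen 𝓒 Y X‖ ≤
      Y.card * ν (diam Y) * (F.weightedNorm w X + F.bdWeight 𝓒 ν) := by
  have norm_le : ‖F.nearGen 𝓒 Y X‖ ≤ ∑ y ∈ Y, F.siteNorm X y +
      ∑ p ∈ bdIndex 𝓒 with ¬ Disjoint (bdSupport p.1 p.2) Y, F.bdNorm p.1 p.2 :=
    h.norm_sum_bulkTerm_add_sum_bdTerm_le
      (fun Z hZ => by rwa [Finset.mem_filter, Finset.mem_powerset] at hZ)
      (Finset.filter_subset _ _) hX
  have bdWeight_le : ν (diam Y) * F.bdWeight 𝓒 ν ≤ Y.card * ν (diam Y) * F.bdWeight 𝓒 ν := by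
    rw [mul_assoc]
    exact le_mul_of_one_le_left (mul_nonneg (h.pos _).le h.bdWeight_nonneg)
      (mod_cast Finset.card_pos.2 ⟨x, hx⟩)
  calc w x * ‖F.nearGen 𝓒 Y X‖
      ≤ w x * (∑ y ∈ Y, F.siteNorm X y +
          ∑ p ∈ bdIndex 𝓒 with ¬ Disjoint (bdSupport p.1 p.2) Y, F.bdNorm p.1 p.2) :=
        mul_le_mul_of_nonneg_left norm_le (hw.pos x).le
    _ ≤ Y.card * ν (diam Y) * F.weightedNorm w X + Y.card * ν (diam Y) * F.bdWeight 𝓒 ν := by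
        rw [mul_add]
        exact add_le_add (h.mul_sum_siteNorm_le hw hY hx X)
          ((h.mul_sum_bdNorm_le hw hx).trans bdWeight_le)
    _ = Y.card * ν (diam Y) * (F.weightedNorm w X + F.bdWeight 𝓒 ν) := (mul_add _ _ _).symm

theorem norm_evolution_closedGen_le_one (hX₀ : ‖X₀‖ ≤ 1) (ht : 0 ≤ t) :
    ‖evolution (F.closedGen 𝓒) t X₀‖ ≤ 1 :=
  ((F.isDissipative_closedGen 𝓒).norm_evolution_le X₀ ht).trans hX₀

theorem continuous_weightedNorm_evolution (F : UniformFamily D q) (w : Site D → ℝ)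
    (X₀ : Op q (region 𝓒)) :
    Continuous fun t => F.weightedNorm w (evolution (F.closedGen 𝓒) t X₀) :=
  (F.continuous_weightedNorm w).comp <| continuous_iff_continuousAt.2 fun t =>
    (hasDerivAt_evolution (F.closedGen 𝓒) X₀ t).continuousAt

theorem LiebRobinson.mul_norm_bulkTerm_apply_le (h : F.LiebRobinson ν v) (hX : ‖X‖ ≤ 1)
    (hXY : F.bulkTerm (region 𝓒) Y X = 0 ∨ ∀ x ∈ Y, w x ≤ ν (diam Y)) (hx : x ∈ Y) :
    w x * ‖F.bulkTerm (region 𝓒) Y X‖ ≤ F.bulkNorm Y * (Y.card * ν (diam Y)) := by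
  have diam_nonneg : 0 ≤ ν (diam Y) := (h.pos _).le
  rcases hXY with apply_eq_zero | weight_le
  · rw [apply_eq_zero, norm_zero, mul_zero]
    exact mul_nonneg (F.bulkNorm_nonneg Y) (mul_nonneg (Nat.cast_nonneg _) diam_nonneg)
  · have one_le_card : (1 : ℝ) ≤ Y.card := mod_cast Finset.card_pos.2 ⟨x, hx⟩
    have norm_le : ‖F.bulkTerm (region 𝓒) Y X‖ ≤ F.bulkNorm Y :=
      (h.norm_bulkTerm_apply_le ⟨x, hx⟩ X).trans (mul_le_of_le_one_right (F.bulkNorm_nonneg Y) hX)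
    rw [mul_comm (F.bulkNorm Y)]
    exact mul_le_mul ((weight_le x hx).trans (le_mul_of_one_le_left diam_nonneg one_le_card))
      norm_le (norm_nonneg _) (mul_nonneg (Nat.cast_nonneg _) diam_nonneg)

theorem LiebRobinson.mul_norm_bulkTerm_evolution_le (h : F.LiebRobinson ν v)
    (hw : IsAdmissibleWeight ν 𝓒 w) (hX₀ : ‖X₀‖ ≤ 1)
    (hY₀ : F.bulkTerm (region 𝓒) Y X₀ = 0 ∨ ∀ x ∈ Y, w x ≤ ν (diam Y))
    (hY : Y ⊆ region 𝓒) (hx : x ∈ Y) (ht : 0 ≤ t) :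
    w x * ‖F.bulkTerm (region 𝓒) Y (evolution (F.closedGen 𝓒) t X₀)‖ ≤
      F.bulkNorm Y * (Y.card * ν (diam Y)) * (1 + ∫ s in (0 : ℝ)..t,
        (F.weightedNorm w (evolution (F.closedGen 𝓒) s X₀) + F.bdWeight 𝓒 ν)) := by
  set u : ℝ → Op q (region 𝓒) := fun s => evolution (F.closedGen 𝓒) s X₀
  have hasDerivAt_u : ∀ s, HasDerivAt u ((F.farGen 𝓒 Y + F.nearGen 𝓒 Y) (u s)) s := fun s => by
    rw [farGen_add_nearGen]
    exact hasDerivAt_evolution _ _ s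
  have near_le : ∀ s, 0 ≤ s → ‖F.nearGen 𝓒 Y (u s)‖ ≤ Y.card * ν (diam Y) / w x *
      (F.weightedNorm w (u s) + F.bdWeight 𝓒 ν) := fun s hs => by
    rw [div_mul_eq_mul_div, le_div_iff₀' (hw.pos x)]
    exact h.mul_norm_nearGen_apply_le hw hY hx (norm_evolution_closedGen_le_one hX₀ hs)
  have initial_le : w x * ‖F.bulkTerm (region 𝓒) Y (u 0)‖ ≤
      F.bulkNorm Y * (Y.card * ν (diam Y)) := by
    simp only [u, evolution_zero]
    exact h.mul_norm_bulkTerm_apply_le hX₀ hY₀ hx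
  have continuous_rate : Continuous fun s => Y.card * ν (diam Y) / w x *
      (F.weightedNorm w (u s) + F.bdWeight 𝓒 ν) :=
    continuous_const.mul ((continuous_weightedNorm_evolution F w X₀).add continuous_const)
  have norm_le := (F.isDissipative_farGen 𝓒 Y).norm_apply_le_add_integral
    (F.commute_bulkTerm_farGen 𝓒 Y) hasDerivAt_u (F.bulkNorm_nonneg Y)
    (h.norm_bulkTerm_apply_le ⟨x, hx⟩) continuous_rate near_le ht
  rw [intervalIntegral.integral_const_mul] at norm_le
  refine (mul_le_mul_of_nonneg_left norm_le (hw.pos x).le).trans ?_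
  rw [mul_add, mul_add, mul_one]
  refine add_le_add initial_le (le_of_eq ?_)
  have := (hw.pos x).ne'
  simp only [u]
  field_simp

theorem LiebRobinson.weightedNorm_evolution_le (h : F.LiebRobinson ν v)
    (hw : IsAdmissibleWeight ν 𝓒 w) (hX₀ : ‖X₀‖ ≤ 1)
    (hwX₀ : ∀ Z ⊆ region 𝓒, F.bulkTerm (region 𝓒) Z X₀ = 0 ∨ ∀ x ∈ Z, w x ≤ ν (diam Z))
    (ht : 0 ≤ t) : F.weightedNorm w (evolution (F.closedGen 𝓒) t X₀) ≤
      (v + F.bdWeight 𝓒 ν) * Real.exp (v * t) := by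
  refine le_mul_exp_of_le_integral (continuous_weightedNorm_evolution F w X₀) h.nonneg
    h.bdWeight_nonneg (fun _ => norm_nonneg _) (fun t ht => ?_) ht
  set I := ∫ s in (0 : ℝ)..t, (F.weightedNorm w (evolution (F.closedGen 𝓒) s X₀) + F.bdWeight 𝓒 ν)
  have I_nonneg : 0 ≤ 1 + I := add_nonneg zero_le_one <|
    intervalIntegral.integral_nonneg ht fun _ _ => add_nonneg (norm_nonneg _) h.bdWeight_nonneg
  refine (pi_norm_le_iff_of_nonneg (mul_nonneg h.nonneg I_nonneg)).2 fun x => ?_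
  rw [Real.norm_of_nonneg (mul_nonneg (hw.pos _).le (F.siteNorm_nonneg _ _))]
  calc w x * F.siteNorm (evolution (F.closedGen 𝓒) t X₀) x
      ≤ ∑ Z ∈ (region 𝓒).powerset with x.1 ∈ Z,
          F.bulkNorm Z * (Z.card * ν (diam Z)) * (1 + I) := by
        rw [siteNorm, Finset.mul_sum]
        refine Finset.sum_le_sum fun Z hZ => ?_
        rw [Finset.mem_filter, Finset.mem_powerset] at hZ
        exact h.mul_norm_bulkTerm_evolution_le hw hX₀ (hwX₀ Z hZ.1) hZ.1 hZ.2 ht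
    _ ≤ v * (1 + I) := by
        rw [← Finset.sum_mul]
        exact mul_le_mul_of_nonneg_right
          (h.sum_bulkNorm_le fun Z hZ => (Finset.mem_filter.1 hZ).2) I_nonneg

theorem LiebRobinson.norm_closedGen_sub_cutGen_apply_le (h : F.LiebRobinson ν v) {m k : ℕ}
    (hmk : m ≤ k) (hA : A ⊆ region 𝓒) (hwA : ∀ a ∈ A, ν m ≤ w a) (hX : ‖X‖ ≤ 1) :
    ‖(F.closedGen 𝓒 - F.cutGen 𝓒 A k) X‖ ≤
      (A.card * F.weightedNorm w X + F.bdWeight 𝓒 ν) * (ν m)⁻¹ := by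
  have site_le : ν m * ∑ a ∈ A, F.siteNorm X a ≤ A.card * F.weightedNorm w X := by
    rw [Finset.mul_sum, ← nsmul_eq_mul]
    exact Finset.sum_le_card_nsmul _ _ _ fun a ha =>
      (mul_le_mul_of_nonneg_right (hwA a ha) (F.siteNorm_nonneg X a)).trans
        (F.mul_siteNorm_le_weightedNorm w X (hA ha))
  have bd_le : ν m * ∑ p ∈ bdIndex 𝓒 with ¬ p.2 ≤ k, F.bdNorm p.1 p.2 ≤ F.bdWeight 𝓒 ν := by
    rw [Finset.mul_sum, bdWeight]
    refine (Finset.sum_le_sum fun p hp => ?_).trans <| Finset.sum_le_sum_of_subset_of_nonneg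
      (Finset.filter_subset _ _) fun p _ _ => mul_nonneg (h.pos _).le (F.bdNorm_nonneg _ _)
    have := (Finset.mem_filter.1 hp).2
    exact mul_le_mul_of_nonneg_right (h.mono (by omega)) (F.bdNorm_nonneg _ _)
  rw [← div_eq_mul_inv, le_div_iff₀' (h.pos m), closedGen_sub_cutGen]
  refine (mul_le_mul_of_nonneg_left (h.norm_sum_bulkTerm_add_sum_bdTerm_le (Y := A)
    (fun Z hZ => by rwa [Finset.mem_filter, Finset.mem_powerset] at hZ)
    (Finset.filter_subset _ _) hX) (h.pos m).le).trans ?_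
  rw [mul_add]
  exact add_le_add site_le bd_le

theorem LiebRobinson.norm_evolution_closedGen_sub_evolution_cutGen_le (h : F.LiebRobinson ν v)
    (hw : IsAdmissibleWeight ν 𝓒 w) {m k : ℕ} (hmk : m ≤ k) (hA : A ⊆ region 𝓒)
    (hwA : ∀ a ∈ A, ν m ≤ w a) (hX₀ : ‖X₀‖ ≤ 1)
    (hwX₀ : ∀ Z ⊆ region 𝓒, F.bulkTerm (region 𝓒) Z X₀ = 0 ∨ ∀ x ∈ Z, w x ≤ ν (diam Z))
    (ht : 0 ≤ t) :
    ‖evolution (F.closedGen 𝓒) t X₀ - evolution (F.cutGen 𝓒 A k) t X₀‖ ≤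
      (A.card * (1 + v⁻¹) * (v + F.bdWeight 𝓒 ν) + F.bdWeight 𝓒 ν) * (ν m)⁻¹ *
        (Real.exp (v * t) - 1 + t) := by
  set β := F.bdWeight 𝓒 ν
  set C := A.card * (1 + v⁻¹) * (v + β) + β
  have β_nonneg : 0 ≤ β := h.bdWeight_nonneg
  have hasDerivAt_bound : ∀ s, HasDerivAt (fun s => C * (ν m)⁻¹ * (Real.exp (v * s) - 1 + s))
      (C * (ν m)⁻¹ * (Real.exp (v * s) * v + 1)) s := fun s => by
    have hasDerivAt_exp : HasDerivAt (fun s => Real.exp (v * s)) (Real.exp (v * s) * v) s := by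
      simpa only [id, mul_one] using ((hasDerivAt_id s).const_mul v).exp
    exact ((hasDerivAt_exp.sub_const 1).add (hasDerivAt_id s)).const_mul _
  rw [norm_sub_rev]
  refine (F.isDissipative_cutGen 𝓒 A k).norm_sub_le_of_hasDerivAt
    (hasDerivAt_evolution _ X₀) (hasDerivAt_evolution _ X₀) ?_ hasDerivAt_bound (by simp)
    (fun s hs => ?_) ht
  · rw [evolution_zero, evolution_zero]
  have rate_nonneg : 0 ≤ Real.exp (v * s) * v := mul_nonneg (Real.exp_pos _).le h.nonneg
  rw [← neg_sub, LinearMap.neg_apply, norm_neg]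
  calc ‖(F.closedGen 𝓒 - F.cutGen 𝓒 A k) (evolution (F.closedGen 𝓒) s X₀)‖
      ≤ (A.card * ((v + β) * Real.exp (v * s)) + β) * (ν m)⁻¹ := by
        refine (h.norm_closedGen_sub_cutGen_apply_le hmk hA hwA
          (norm_evolution_closedGen_le_one hX₀ hs)).trans ?_
        have := inv_nonneg.2 (h.pos m).le
        gcongr
        exact h.weightedNorm_evolution_le hw hX₀ hwX₀ hs
    _ ≤ (A.card * ((v + β) * ((1 + v⁻¹) * (Real.exp (v * s) * v + 1))) +
          β * (Real.exp (v * s) * v + 1)) * (ν m)⁻¹ := by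
        have := inv_nonneg.2 (h.pos m).le
        have := h.nonneg
        gcongr
        · exact exp_le_mul_exp_mul_add_one h.nonneg s
        · exact le_mul_of_one_le_right β_nonneg (le_add_of_nonneg_left rate_nonneg)
    _ = C * (ν m)⁻¹ * (Real.exp (v * s) * v + 1) := by ring

end LightCone

end UniformFamily

/-! ### Balls, hulls and depth -/

section Geometry

variable {D : ℕ} {A : Finset (Site D)} {s : ℕ} {𝓒 : Finset (Site D × ℕ)}

theorem siteDist_update_add (x y : Site D) (i : Fin D) (a : ℤ) :
    siteDist (Function.update x i a) y + (x i - y i).natAbs =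
      siteDist x y + (a - y i).natAbs := by
  have erase_eq : ∑ j ∈ Finset.univ.erase i, (Function.update x i a j - y j).natAbs =
      ∑ j ∈ Finset.univ.erase i, (x j - y j).natAbs :=
    Finset.sum_congr rfl fun j hj => by rw [Function.update_of_ne (Finset.ne_of_mem_erase hj)]
  unfold siteDist
  rw [← Finset.add_sum_erase _ _ (Finset.mem_univ i), erase_eq, Function.update_self,
    ← Finset.add_sum_erase _ (fun j => (x j - y j).natAbs) (Finset.mem_univ i)]
  ring

theorem siteDist_update_self (x : Site D) (i : Fin D) (a : ℤ) :
    siteDist x (Function.update x i a) = (x i - a).natAbs := by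
  unfold siteDist
  rw [Finset.sum_eq_single_of_mem i (Finset.mem_univ i) fun j _ hj => by
    rw [Function.update_of_ne hj, sub_self, Int.natAbs_zero], Function.update_self]

theorem exists_siteDist_add_one_eq {x y : Site D} (hxy : siteDist x y ≠ 0) :
    ∃ z, siteDist x z ≤ 1 ∧ siteDist z y + 1 = siteDist x y := by
  obtain ⟨i, -, hi⟩ : ∃ i ∈ Finset.univ, (x i - y i).natAbs ≠ 0 := by
    by_contra! coords_eq
    exact hxy (Finset.sum_eq_zero coords_eq)
  let a := if x i < y i then x i + 1 else x i - 1
  have dist_add := siteDist_update_add x y i a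
  refine ⟨Function.update x i a, ?_, ?_⟩
  · rw [siteDist_update_self]
    grind
  · grind

theorem IsDisjointUnion.exists_notMem_region (h𝓒 : IsDisjointUnion 𝓒) {c : Site D × ℕ}
    (hc : c ∈ 𝓒) {y z : Site D} (hy : y ∈ ball c.1 c.2) (hz : z ∉ ball c.1 c.2) :
    ∃ z', z' ∉ region 𝓒 ∧ siteDist y z' ≤ siteDist y z := by
  -- Where a shortest path from `y` to `z` leaves the ball `c`, it leaves all balls of `𝓒`.
  obtain ⟨n, hn⟩ : ∃ n, siteDist y z = n := ⟨_, rfl⟩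
  induction n generalizing y with
  | zero =>
    refine absurd (mem_ball.2 ?_) hz
    have := siteDist_triangle c.1 y z
    have := mem_ball.1 hy
    omega
  | succ n ih =>
    obtain ⟨y', dist_le_one, dist_add_one⟩ :=
      exists_siteDist_add_one_eq (x := y) (y := z) (by omega)
    by_cases hy' : y' ∈ ball c.1 c.2
    · obtain ⟨z', hz', dist_le⟩ := ih hy' (by omega)
      have := siteDist_triangle y y' z'
      exact ⟨z', hz', by omega⟩
    · refine ⟨y', fun mem_region => ?_, by omega⟩
      obtain ⟨c', hc', hy'c'⟩ := Finset.mem_biUnion.1 mem_region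
      have := h𝓒 c hc c' hc' (fun eq => hy' (eq ▸ hy'c')) y hy y' hy'c'
      omega

theorem center_mem_ball (u : Site D) (r : ℕ) : u ∈ ball u r :=
  mem_ball.2 ((siteDist_self u).trans_le (Nat.zero_le r))

theorem le_card_ball (hD : 1 ≤ D) (u : Site D) (r : ℕ) : r ≤ (ball u r).card := by
  let i : Fin D := ⟨0, hD⟩
  refine (Finset.card_range r).symm.trans_le <|
    Finset.card_le_card_of_injOn (fun j => Function.update u i (u i + j))
      (fun j hj => ?_) fun j _ k _ hjk => ?_
  · rw [Finset.mem_coe, Finset.mem_range] at hj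
    rw [Finset.mem_coe, mem_ball, siteDist_update_self]
    omega
  · simpa using congrFun hjk i

theorem card_ball_le (u : Site D) (r : ℕ) : (ball u r).card ≤ (2 * r + 1) ^ D := by
  refine (Finset.card_filter_le _ _).trans_eq ?_
  have side_eq : ∀ i, (u i + r + 1 - (u i - r)).toNat = 2 * r + 1 := fun i => by omega
  simp only [Pi.card_Icc, Int.card_Icc, side_eq, Finset.prod_const, Finset.card_univ,
    Fintype.card_fin]

theorem IsDisjointUnion.card_le_card_region (h𝓒 : IsDisjointUnion 𝓒) :
    𝓒.card ≤ (region 𝓒).card := by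
  refine Finset.card_le_card_of_injOn Prod.fst
    (fun c hc => ball_subset_region hc (center_mem_ball c.1 c.2)) fun c hc c' hc' centers_eq => ?_
  by_contra hne
  have := h𝓒 c hc c' hc' hne c.1 (center_mem_ball _ _) c'.1 (center_mem_ball _ _)
  rw [centers_eq, siteDist_self] at this
  omega

theorem radius_le_card_region (hD : 1 ≤ D) {c : Site D × ℕ} (hc : c ∈ 𝓒) :
    c.2 ≤ (region 𝓒).card :=
  (le_card_ball hD c.1 c.2).trans (Finset.card_le_card (ball_subset_region hc))

theorem region_singleton (u : Site D) (r : ℕ) : region {(u, r)} = ball u r :=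
  Finset.singleton_biUnion

theorem isDisjointUnion_singleton (c : Site D × ℕ) : IsDisjointUnion {c} :=
  fun _ ha _ hb hab =>
    absurd ((Finset.mem_singleton.1 ha).trans (Finset.mem_singleton.1 hb).symm) hab

theorem nbhd_subset_ball {u : Site D} {r : ℕ} (hA : A ⊆ ball u r) (s : ℕ) :
    nbhd A s ⊆ ball u (r + s) := fun x hx => by
  obtain ⟨a, ha, hxa⟩ := Finset.mem_biUnion.1 hx
  rw [mem_ball] at hxa ⊢
  have := mem_ball.1 (hA ha)
  have := siteDist_triangle u a x
  omega

theorem IsHull.card_region_le (h : IsHull A s 𝓒) {u : Site D} {r : ℕ} (hA : A ⊆ ball u r) :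
    (region 𝓒).card ≤ (2 * (r + s) + 1) ^ D := by
  refine (h.2.2 {(u, r + s)} (isDisjointUnion_singleton _) ?_).trans ?_ <;>
    rw [region_singleton]
  exacts [nbhd_subset_ball hA s, card_ball_le u _]

theorem exists_subset_ball (A : Finset (Site D)) (u : Site D) : ∃ r, A ⊆ ball u r :=
  ⟨A.sup (siteDist u), fun _ ha => mem_ball.2 (Finset.le_sup (f := siteDist u) ha)⟩

theorem subset_nbhd (A : Finset (Site D)) (s : ℕ) : A ⊆ nbhd A s := fun a ha =>
  Finset.mem_biUnion.2 ⟨a, ha, center_mem_ball a s⟩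

/-- The depth `max(0, s + 1 - dist(x, A))` of the site `x` in the neighbourhood `nbhd A s`. -/
def depth (A : Finset (Site D)) (s : ℕ) (x : Site D) : ℕ := A.sup fun a => s + 1 - siteDist a x

theorem depth_le_add_siteDist (A : Finset (Site D)) (s : ℕ) (x y : Site D) :
    depth A s x ≤ depth A s y + siteDist x y := by
  refine Finset.sup_le fun a ha => ?_
  have le_depth : s + 1 - siteDist a y ≤ depth A s y :=
    Finset.le_sup (f := fun a => s + 1 - siteDist a y) ha
  have := siteDist_triangle a y x
  have := siteDist_triangle a x y
  omega

theorem le_depth {x : Site D} (hx : x ∈ A) (s : ℕ) : s ≤ depth A s x := by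
  have sub_le_depth : s + 1 - siteDist x x ≤ depth A s x :=
    Finset.le_sup (f := fun a => s + 1 - siteDist a x) hx
  rw [siteDist_self] at sub_le_depth
  omega

theorem depth_eq_zero {x : Site D} (hx : x ∉ nbhd A s) : depth A s x = 0 := by
  refine Nat.le_zero.1 (Finset.sup_le fun a ha => ?_)
  have : ¬ siteDist a x ≤ s := fun le => hx (Finset.mem_biUnion.2 ⟨a, ha, mem_ball.2 le⟩)
  omega

theorem depth_le_diam {Z : Finset (Site D)} (hZ : ¬ Z ⊆ nbhd A s) {x : Site D} (hx : x ∈ Z) :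
    depth A s x ≤ diam Z := by
  obtain ⟨z, hz, hzA⟩ := Finset.not_subset.1 hZ
  calc depth A s x ≤ depth A s z + siteDist x z := depth_le_add_siteDist A s x z
    _ = siteDist x z := by rw [depth_eq_zero hzA, zero_add]
    _ ≤ diam Z := siteDist_le_diam hx hz

theorem depth_le_of_mem_bdry (h𝓒 : IsDisjointUnion 𝓒) (hA : nbhd A s ⊆ region 𝓒)
    {c : Site D × ℕ} (hc : c ∈ 𝓒) {d : ℕ} {y : Site D} (hy : y ∈ bdry d (ball c.1 c.2)) :
    depth A s y ≤ d := by
  classical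
  obtain ⟨hyc, z, hz, hyz⟩ := Finset.mem_filter.1 hy
  obtain ⟨z', hz', dist_le⟩ := h𝓒.exists_notMem_region hc hyc hz
  calc depth A s y ≤ depth A s z' + siteDist y z' := depth_le_add_siteDist A s y z'
    _ = siteDist y z' := by rw [depth_eq_zero fun h => hz' (hA h), zero_add]
    _ ≤ d := dist_le.trans hyz

end Geometry

/-! ### Polynomial bounds -/

theorem exists_polynomial_abs_eval_le (P : Polynomial ℝ) :
    ∃ Q : Polynomial ℝ, ∀ x y, 0 ≤ x → x ≤ y → |P.eval x| ≤ Q.eval y := by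
  induction P using Polynomial.induction_on' with
  | add P P' hP hP' =>
    obtain ⟨Q, hQ⟩ := hP
    obtain ⟨Q', hQ'⟩ := hP'
    refine ⟨Q + Q', fun x y hx hxy => ?_⟩
    rw [Polynomial.eval_add, Polynomial.eval_add]
    exact (abs_add_le _ _).trans (add_le_add (hQ x y hx hxy) (hQ' x y hx hxy))
  | monomial n a =>
    refine ⟨Polynomial.monomial n |a|, fun x y hx hxy => ?_⟩
    rw [Polynomial.eval_monomial, Polynomial.eval_monomial, abs_mul,
      abs_of_nonneg (pow_nonneg hx n)]
    gcongr

namespace UniformFamily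

variable {D : ℕ} {q : Site D → ℕ} {F : UniformFamily D q} {ν : ℕ → ℝ} {v : ℝ}
  {A : Finset (Site D)} {𝓒 : Finset (Site D × ℕ)}

theorem card_bdIndex_le {n : ℕ} (h𝓒 : 𝓒.card ≤ n) (hn : ∀ c ∈ 𝓒, c.2 ≤ n) :
    (bdIndex 𝓒).card ≤ n * (n + 1) := by
  rw [bdIndex, Finset.card_sigma]
  refine (Finset.sum_le_card_nsmul _ _ (n + 1) fun c _ => ?_).trans ?_
  · simpa only [Nat.card_Icc, Nat.add_sub_cancel] using Nat.succ_le_succ (hn c c.2)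
  · rw [Finset.card_univ, Fintype.card_coe, smul_eq_mul]
    exact Nat.mul_le_mul_right _ h𝓒

theorem LiebRobinson.exists_bdWeight_le (h : F.LiebRobinson ν v) :
    ∃ Q : Polynomial ℝ, ∀ (𝓒 : Finset (Site D × ℕ)) (n : ℕ), 𝓒.card ≤ n →
      (∀ c ∈ 𝓒, c.2 ≤ n) → F.bdWeight 𝓒 ν ≤ Q.eval (n : ℝ) := by
  obtain ⟨P, hP⟩ := h.exists_mul_sum_bdNorm_le
  obtain ⟨Q, hQ⟩ := exists_polynomial_abs_eval_le P
  refine ⟨.X * (.X + 1) * Q, fun 𝓒 n h𝓒 hn => ?_⟩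
  have Q_nonneg : 0 ≤ Q.eval (n : ℝ) :=
    (abs_nonneg _).trans (hQ n n (Nat.cast_nonneg n) le_rfl)
  have term_le : ∀ p ∈ bdIndex 𝓒, ν p.2 * F.bdNorm p.1 p.2 ≤ Q.eval (n : ℝ) := fun p hp => by
    obtain ⟨one_le, le⟩ := Finset.mem_Icc.1 (Finset.mem_sigma.1 hp).2
    calc ν p.2 * F.bdNorm p.1 p.2
        ≤ ν p.2 * ∑ d ∈ Finset.Icc p.2 (p.1.1.2 + 1), F.bdNorm p.1 d :=
          mul_le_mul_of_nonneg_left (Finset.single_le_sum (fun d _ => F.bdNorm_nonneg p.1 d)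
            (Finset.left_mem_Icc.2 le)) (h.pos _).le
      _ ≤ |P.eval (p.1.1.2 : ℝ)| := hP p.1 p.2 one_le
      _ ≤ Q.eval (n : ℝ) := hQ _ _ (Nat.cast_nonneg _) (Nat.cast_le.2 (hn p.1 p.1.2))
  calc F.bdWeight 𝓒 ν ≤ (bdIndex 𝓒).card • Q.eval (n : ℝ) := Finset.sum_le_card_nsmul _ _ _ term_le
    _ ≤ (n * (n + 1) : ℕ) • Q.eval (n : ℝ) :=
        nsmul_le_nsmul_left Q_nonneg (card_bdIndex_le h𝓒 hn)
    _ = (.X * (.X + 1) * Q : Polynomial ℝ).eval (n : ℝ) := by simp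

theorem LiebRobinson.exists_bdWeight_le_of_isHull (h : F.LiebRobinson ν v) (hD : 1 ≤ D)
    (A : Finset (Site D)) : ∃ Q : Polynomial ℝ, ∀ (s : ℕ) (𝓒 : Finset (Site D × ℕ)),
      IsHull A s 𝓒 → F.bdWeight 𝓒 ν ≤ Q.eval (s : ℝ) := by
  obtain ⟨Q, hQ⟩ := h.exists_bdWeight_le
  obtain ⟨r, hr⟩ := exists_subset_ball A 0
  refine ⟨Q.comp ((2 * (.C (r : ℝ) + .X) + 1) ^ D), fun s 𝓒 h𝓒 => ?_⟩
  have card_le := h𝓒.card_region_le hr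
  simpa using hQ 𝓒 _ (h𝓒.1.card_le_card_region.trans card_le)
    fun c hc => (radius_le_card_region hD hc).trans card_le

theorem LiebRobinson.isAdmissibleWeight_depth (h : F.LiebRobinson ν v) (h𝓒 : IsDisjointUnion 𝓒)
    {s : ℕ} (hA : nbhd A s ⊆ region 𝓒) : IsAdmissibleWeight ν 𝓒 fun x => ν (depth A s x) where
  pos _ := h.pos _
  le_mul x y := (h.mono (depth_le_add_siteDist A s x y)).trans (h.submul _ _)
  le_of_mem_bdSupport _ hc _ _ hy := h.mono (depth_le_of_mem_bdry h𝓒 hA hc hy)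

theorem FrustrationFree.bulkTerm_tensor_eq_zero (hF : F.FrustrationFree)
    {Λ Z : Finset (Site D)} (h𝓒 : IsDisjointUnion 𝓒) (hΛ : region 𝓒 ⊆ Λ)
    {ρ : Op q (region 𝓒)} (hρ : F.IsFixedState 𝓒 ρ) (τ : Op q (Λ \ region 𝓒))
    (hZ : Z ⊆ region 𝓒) : F.bulkTerm Λ Z (tensor hΛ ρ τ) = 0 := by
  rw [F.bulkTerm_of_subset (hZ.trans hΛ), extend_tensor hZ hΛ, hF 𝓒 h𝓒 ρ hρ Z hZ, tensor_zero]

end UniformFamily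

end OpenLattice

theorem mainTheorem4 {D : ℕ} (hD : 1 ≤ D) (q : Site D → ℕ) (F : UniformFamily D q)
    (ν : ℕ → ℝ) (v : ℝ) (hLR : F.LiebRobinson ν v) (hFF : F.FrustrationFree)
    (A : Finset (Site D)) :
    ∃ P : Polynomial ℝ, ∀ m : ℕ, 1 ≤ m →
      ∀ 𝓐 𝓑 : Finset (Site D × ℕ), IsHull A m 𝓐 → IsHull A (m + 1) 𝓑 →
      ∀ hsub : region 𝓐 ⊆ region 𝓑,
      ∀ ρ : Op q (region 𝓐), F.IsFixedState 𝓐 ρ →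
      ∀ τ : Op q (region 𝓑 \ region 𝓐), IsState τ →
      ∀ t : ℝ, 0 ≤ t →
        traceNorm (evolution (F.closedGen 𝓑) t (tensor hsub ρ τ) -
            evolution (F.cutGen 𝓑 A (m + 1)) t (tensor hsub ρ τ)) ≤
          P.eval (m : ℝ) * (ν m)⁻¹ * (Real.exp (v * t) - 1 + t) := by
  obtain ⟨Q, hQ⟩ := hLR.exists_bdWeight_le_of_isHull hD A
  refine ⟨.C (A.card * (1 + v⁻¹)) * (.C v + Q.comp (.X + 1)) + Q.comp (.X + 1),
    fun m _ 𝓐 𝓑 h𝓐 h𝓑 hsub ρ hρ τ hτ t ht => ?_⟩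
  have nbhd_subset : nbhd A m ⊆ region 𝓑 := h𝓐.2.1.trans hsub
  have bulkTerm_eq_zero_or : ∀ Z ⊆ region 𝓑, F.bulkTerm (region 𝓑) Z (tensor hsub ρ τ) = 0 ∨
      ∀ x ∈ Z, ν (depth A m x) ≤ ν (diam Z) := fun Z _ => by
    by_cases hZ : Z ⊆ nbhd A m
    · exact .inl (hFF.bulkTerm_tensor_eq_zero h𝓐.1 hsub hρ τ (hZ.trans h𝓐.2.1))
    · exact .inr fun x hx => hLR.mono (depth_le_diam hZ hx)
  refine (hLR.norm_evolution_closedGen_sub_evolution_cutGen_le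
    (hLR.isAdmissibleWeight_depth h𝓑.1 nbhd_subset) m.le_succ
    ((subset_nbhd A m).trans nbhd_subset) (fun a ha => hLR.mono (le_depth ha m))
    (hρ.1.tensor hτ).traceNorm_le_one bulkTerm_eq_zero_or ht).trans ?_
  have bdWeight_le : F.bdWeight 𝓑 ν ≤ (Q.comp (.X + 1)).eval (m : ℝ) := by
    simpa using hQ (m + 1) 𝓑 h𝓑
  have inv_v_nonneg : 0 ≤ v⁻¹ := inv_nonneg.2 hLR.nonneg
  have inv_ν_nonneg : 0 ≤ (ν m)⁻¹ := inv_nonneg.2 (hLR.pos m).le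
  have time_nonneg : 0 ≤ Real.exp (v * t) - 1 + t :=
    add_nonneg (sub_nonneg.2 (Real.one_le_exp (mul_nonneg hLR.nonneg ht))) ht
  rw [Polynomial.eval_add, Polynomial.eval_mul, Polynomial.eval_add, Polynomial.eval_C,
    Polynomial.eval_C]
  gcongr
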